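/- Let $V_n=(M,g)$ and $\bar V_n=(\bar M,\bar g)$ be smooth $n$-dimensional pseudo-Riemannian manifolds (metrics of any signature) with Levi-Civita connections $\nabla$ and $\bar\nabla$. A geodesic mapping of $V_n$ onto $\bar V_n$ is a diffeomorphism $f\colon M\to\bar M$ that maps every geodesic curve of $V_n$ onto a geodesic curve of $\bar V_n$; here a geodesic curve is a regular smooth curve $\gamma$, in any parametrization, with $\nabla_{\dot\gamma}\dot\gamma=\kappa\,\dot\gamma$ for some function $\kappa$ of the parameter. A smooth vector field $\varphi$ on $V_n$ is concircular if there is a smooth function $\varrho$ on $M$ such that $g(\nabla_Y\varphi,X)=\varrho\,g(X,Y)$ for all vector fields $X,Y$; it is of the basic type if $\varrho$ is not identically zero. Theorem. Suppose that $V_n$ admits a geodesic mapping onto $\bar V_n$. If $\bar V_n$ carries a concircular field of the basic type, then $V_n$ also carries a concircular field of the basic type. Moreover, if $V_n$ carries a concircular field of the basic type, then so does $\bar V_n$; thus the class of pseudo-Riemannian manifolds carrying a concircular field of the basic type (equidistant spaces of the basic type) is closed under geodesic mappings. -/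

import Mathlib

open scoped Manifold ContDiff

noncomputable section

/-- A smooth pseudo-Riemannian metric on a manifold `M` modelled on `E`: a smooth field of
symmetric nondegenerate bilinear forms on the tangent spaces (of any signature). -/
structure PseudoRiemannianMetric (E : Type*) [NormedAddCommGroup E] [NormedSpace ℝ E]
    (M : Type*) [TopologicalSpace M] [ChartedSpace E M] [IsManifold 𝓘(ℝ, E) ∞ M] where
  /-- The bilinear form on each tangent space. -/
  form (p : M) : TangentSpace 𝓘(ℝ, E) p →L[ℝ] TangentSpace 𝓘(ℝ, E) p →L[ℝ] ℝ
  symm (p : M) (v w : TangentSpace 𝓘(ℝ, E) p) : form p v w = form p w v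
  nondegenerate (p : M) (v : TangentSpace 𝓘(ℝ, E) p) : (∀ w, form p v w = 0) → v = 0
  contMDiff : ContMDiff 𝓘(ℝ, E) (𝓘(ℝ, E).prod 𝓘(ℝ, E →L[ℝ] E →L[ℝ] ℝ)) ∞
    (fun p ↦ Bundle.TotalSpace.mk' (E →L[ℝ] E →L[ℝ] ℝ)
      (E := fun p : M ↦ TangentSpace 𝓘(ℝ, E) p →L[ℝ] TangentSpace 𝓘(ℝ, E) p →L[ℝ] ℝ) p (form p))

namespace PseudoRiemannianMetric

variable {E : Type*} [NormedAddCommGroup E] [NormedSpace ℝ E]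
  {M : Type*} [TopologicalSpace M] [ChartedSpace E M] [IsManifold 𝓘(ℝ, E) ∞ M]

/-- The components of the metric in the coordinate system `e`, at the coordinates `y`: the
bilinear form `g (∂_u, ∂_v)` of two coordinate vectors `u v : E`. -/
def inChart (g : PseudoRiemannianMetric E M) (e : OpenPartialHomeomorph M E) (y : E) :
    E →L[ℝ] E →L[ℝ] ℝ :=
  ContinuousLinearMap.bilinearComp (E := E) (F := E) (E' := E) (F' := E) (G := ℝ)
    (g.form (e.symm y))
    (mfderiv 𝓘(ℝ, E) 𝓘(ℝ, E) e.symm y) (mfderiv 𝓘(ℝ, E) 𝓘(ℝ, E) e.symm y)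

/-- The Christoffel symbols of the first kind, as a linear form in the last argument `w`:
`½ (∂_u g(v, w) + ∂_v g(u, w) - ∂_w g(u, v))`. -/
def christoffelFirst (g : PseudoRiemannianMetric E M) (e : OpenPartialHomeomorph M E)
    (y u v : E) : E →L[ℝ] ℝ :=
  (1 / 2 : ℝ) • (fderiv ℝ (g.inChart e) y u v + fderiv ℝ (g.inChart e) y v u
    - ((fderiv ℝ (g.inChart e) y).flip u).flip v)

/-- The Christoffel symbols (of the second kind) of the Levi-Civita connection in the coordinate
system `e`: the vector `Γ(u, v)` obtained by raising the index of `christoffelFirst`. -/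
def christoffel (g : PseudoRiemannianMetric E M) (e : OpenPartialHomeomorph M E)
    (y u v : E) : E :=
  ContinuousLinearMap.inverse (g.inChart e y) (g.christoffelFirst e y u v)

end PseudoRiemannianMetric

section Fields

variable {E : Type*} [NormedAddCommGroup E] [NormedSpace ℝ E]
  {M : Type*} [TopologicalSpace M] [ChartedSpace E M] [IsManifold 𝓘(ℝ, E) ∞ M]

/-- The components of a vector field in the coordinate system `e`, at the coordinates `y`. -/
def vectorInChart (X : (p : M) → TangentSpace 𝓘(ℝ, E) p) (e : OpenPartialHomeomorph M E)
    (y : E) : E :=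
  mfderiv 𝓘(ℝ, E) 𝓘(ℝ, E) e (e.symm y) (X (e.symm y))

/-- The covariant derivative `∇_u X` with respect to the Levi-Civita connection of `g`,
in the coordinate system `e`: `∂_u X + Γ(u, X)`. -/
def covDerivInChart (g : PseudoRiemannianMetric E M) (X : (p : M) → TangentSpace 𝓘(ℝ, E) p)
    (e : OpenPartialHomeomorph M E) (y u : E) : E :=
  fderiv ℝ (vectorInChart X e) y u + g.christoffel e y u (vectorInChart X e y)

/-- `φ` is a concircular vector field with the scalar field `ρ`: both are smooth, and
`g (∇_Y φ, X) = ρ g (X, Y)` for all `X`, `Y` (in every coordinate system). -/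
structure IsConcircular (g : PseudoRiemannianMetric E M) (φ : (p : M) → TangentSpace 𝓘(ℝ, E) p)
    (ρ : M → ℝ) : Prop where
  smooth_field : ContMDiff 𝓘(ℝ, E) 𝓘(ℝ, E).tangent ∞
    (fun p ↦ (⟨p, φ p⟩ : TangentBundle 𝓘(ℝ, E) M))
  smooth_scalar : ContMDiff 𝓘(ℝ, E) 𝓘(ℝ, ℝ) ∞ ρ
  eq : ∀ e ∈ IsManifold.maximalAtlas 𝓘(ℝ, E) ∞ M, ∀ y ∈ e.target, ∀ X Y : E,
    g.inChart e y (covDerivInChart g φ e y Y) X = ρ (e.symm y) * g.inChart e y X Y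

/-- The space carries a concircular field of the basic type: the scalar field `ρ` is not
identically zero. -/
def HasBasicConcircularField (g : PseudoRiemannianMetric E M) : Prop :=
  ∃ (φ : (p : M) → TangentSpace 𝓘(ℝ, E) p) (ρ : M → ℝ), IsConcircular g φ ρ ∧ ∃ p, ρ p ≠ 0

/-- `γ` restricted to the open interval `J` is a geodesic curve of `g`, in an arbitrary
regular parametrization: it is smooth, its velocity vanishes nowhere, and `∇_{γ'} γ' = κ γ'` for
some function `κ` (in every coordinate system). -/
structure IsGeodesicCurve (g : PseudoRiemannianMetric E M) (J : Set ℝ) (γ : ℝ → M) : Prop where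
  isOpen : IsOpen J
  isPreconnected : IsPreconnected J
  smooth : ContMDiffOn 𝓘(ℝ, ℝ) 𝓘(ℝ, E) ∞ γ J
  regular : ∀ t ∈ J, mfderiv 𝓘(ℝ, ℝ) 𝓘(ℝ, E) γ t ≠ 0
  eq : ∃ κ : ℝ → ℝ, ∀ t ∈ J, ∀ e ∈ IsManifold.maximalAtlas 𝓘(ℝ, E) ∞ M, γ t ∈ e.source →
    deriv (deriv (e ∘ γ)) t + g.christoffel e (e (γ t)) (deriv (e ∘ γ) t) (deriv (e ∘ γ) t)
      = κ t • deriv (e ∘ γ) t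

variable {M' : Type*} [TopologicalSpace M'] [ChartedSpace E M'] [IsManifold 𝓘(ℝ, E) ∞ M']

/-- A geodesic mapping: a diffeomorphism that maps every geodesic curve to a geodesic curve. -/
def IsGeodesicMapping (g : PseudoRiemannianMetric E M) (g' : PseudoRiemannianMetric E M')
    (f : M ≃ₘ⟮𝓘(ℝ, E), 𝓘(ℝ, E)⟯ M') : Prop :=
  ∀ (J : Set ℝ) (γ : ℝ → M), IsGeodesicCurve g J γ → IsGeodesicCurve g' J (f ∘ γ)

/-- `(M, g)` admits a geodesic mapping onto `(M', g')`. -/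
def AdmitsGeodesicMapping (g : PseudoRiemannianMetric E M)
    (g' : PseudoRiemannianMetric E M') : Prop :=
  ∃ f : M ≃ₘ⟮𝓘(ℝ, E), 𝓘(ℝ, E)⟯ M', IsGeodesicMapping g g' f

end Fields

end

/-! Pull both metrics back to one manifold and call them `B` and `H`. Running the geodesics of `B`
through every direction shows that the Levi-Civita connections differ by `ψ(u) v + ψ(v) u`. A trace
computation gives `ψ = dΨ`, where `Ψ` is a multiple of the logarithm of `|det (B⁻¹ H)|`. This
relation is symmetric under exchange of the metrics (`ψ` becomes `-ψ`), so one direction suffices.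

Let `X` be concircular for `B` with scalar `ρ`, and let `∇` be the connection of `H`. The field `P =
e^{-Ψ} X` satisfies `∇_u P = e^{-Ψ} (ρ + dΨ(X)) u`, so it is concircular for `H`. The only
difficulty is that the new scalar may vanish identically. Suppose that `H` has no concircular field
of the basic type. Then `P` is parallel, and `dΨ(P) ≠ 0` wherever `ρ ≠ 0`. The set `U` where `P ≠ 0`
is open and closed, so a basic field on `U` would extend by zero; hence every concircular field on
`U` is parallel.

The operator `A = e^{-2Ψ} B⁻¹ H` and the vector `l = e^{-2Ψ} grad_B Ψ` satisfy `(∇_u A) v = H(u,v) l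
+ H(l,v) u` (`isProjectiveOperator_of_projChange`). The integrability condition of this equation,
evaluated on the parallel field `P`, makes `l` concircular on `U`
(`IsProjectiveOperator.exists_isConcircularOn`), hence parallel there.

For a parallel field `Q` on `U` put `G = H(l, A^m Q)` and `F = H(A^{m+1} Q, Q)`. If the lower
moments vanish, `2 G A Q - F l` is concircular with scalar `2 G H(l, Q)`. Strong induction on `m`
then gives `G = 0` for every `m` (`IsProjectiveOperator.moment_eq_zero`). So `l` is orthogonal to
the span of all `A^m P`. The injective `A` preserves this finite-dimensional span, so `P = A w` with
`w` in it, and `0 = H(l, w) = dΨ(A w) = dΨ(P)`, a contradiction. -/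

set_option maxSynthPendingDepth 3

noncomputable section

/-! ### The Levi-Civita connection on an open set of coordinates. -/

section LocalMetric

open ContinuousLinearMap

variable {E : Type*} [NormedAddCommGroup E] [NormedSpace ℝ E]

/-- The field `b` of bilinear forms restricts to a smooth pseudo-Riemannian metric on the open
subset `D` of the coordinate space. -/
structure IsMetricOn (b : E → E →L[ℝ] E →L[ℝ] ℝ) (D : Set E) : Prop where
  isOpen : IsOpen D
  contDiffOn : ContDiffOn ℝ ∞ b D
  symm : ∀ y ∈ D, ∀ v w, b y v w = b y w v
  nondegenerate : ∀ y ∈ D, ∀ v, (∀ w, b y v w = 0) → v = 0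

/-- The Christoffel symbols of the first kind of `b`, as a trilinear map. -/
def lowerConnection (b : E → E →L[ℝ] E →L[ℝ] ℝ) (y : E) : E →L[ℝ] E →L[ℝ] E →L[ℝ] ℝ :=
  (1 / 2 : ℝ) • (fderiv ℝ b y + (fderiv ℝ b y).flip
    - ((flipₗᵢ ℝ E E ℝ).toContinuousLinearEquiv.toContinuousLinearMap).comp (fderiv ℝ b y).flip)

lemma lowerConnection_apply (b : E → E →L[ℝ] E →L[ℝ] ℝ) (y u v w : E) :
    lowerConnection b y u v w =
      1 / 2 * (fderiv ℝ b y u v w + fderiv ℝ b y v u w - fderiv ℝ b y w u v) := by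
  simp [lowerConnection]

/-- The Christoffel symbols (of the second kind) of `b`, as a bilinear map. -/
def connection (b : E → E →L[ℝ] E →L[ℝ] ℝ) (y : E) : E →L[ℝ] E →L[ℝ] E :=
  (compL ℝ E (E →L[ℝ] ℝ) E (b y).inverse).comp (lowerConnection b y)

lemma connection_apply (b : E → E →L[ℝ] E →L[ℝ] ℝ) (y u v : E) :
    connection b y u v = (b y).inverse (lowerConnection b y u v) := rfl

/-- Nondegeneracy is injectivity, and `E` and its dual have equal dimension. Without invertibility
`ContinuousLinearMap.inverse` would take its default value zero, so raising an index rests on this.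
-/
lemma isInvertible_of_nondegenerate [FiniteDimensional ℝ E] (B : E →L[ℝ] E →L[ℝ] ℝ)
    (hB : ∀ v, (∀ w, B v w = 0) → v = 0) : B.IsInvertible := by
  have hinj : Function.Injective B := by
    refine (injective_iff_map_eq_zero B).2 fun v hv ↦ hB v fun w ↦ by simp [hv]
  have hfin : Module.finrank ℝ E = Module.finrank ℝ (E →L[ℝ] ℝ) := by
    rw [← Subspace.dual_finrank_eq (K := ℝ) (V := E)]
    exact (LinearMap.toContinuousLinearMap (𝕜 := ℝ) (E := E) (F' := ℝ)).finrank_eq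
  refine ⟨(LinearMap.linearEquivOfInjective (B : E →ₗ[ℝ] E →L[ℝ] ℝ) hinj
    hfin).toContinuousLinearEquiv, ?_⟩
  ext v w
  rfl

section Derivatives

variable {F G H : Type*} [NormedAddCommGroup F] [NormedSpace ℝ F] [NormedAddCommGroup G]
  [NormedSpace ℝ G] [NormedAddCommGroup H] [NormedSpace ℝ H] {y : E}

lemma fderiv_lin_apply {c : E → F →L[ℝ] G} {X : E → F} (hc : DifferentiableAt ℝ c y)
    (hX : DifferentiableAt ℝ X y) (u : E) :
    fderiv ℝ (fun z ↦ c z (X z)) y u = fderiv ℝ c y u (X y) + c y (fderiv ℝ X y u) := by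
  rw [fderiv_clm_apply hc hX]
  simp [add_comm]

lemma fderiv_bilin_apply {c : E → F →L[ℝ] G →L[ℝ] H} {X : E → F} {Y : E → G}
    (hc : DifferentiableAt ℝ c y) (hX : DifferentiableAt ℝ X y) (hY : DifferentiableAt ℝ Y y)
    (u : E) : fderiv ℝ (fun z ↦ c z (X z) (Y z)) y u =
      fderiv ℝ c y u (X y) (Y y) + c y (fderiv ℝ X y u) (Y y) + c y (X y) (fderiv ℝ Y y u) := by
  rw [fderiv_lin_apply (hc.clm_apply hX) hY, fderiv_lin_apply hc hX]
  simp

end Derivatives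

namespace IsMetricOn

variable {b : E → E →L[ℝ] E →L[ℝ] ℝ} {D : Set E} {y : E}

lemma ext (hb : IsMetricOn b D) (hy : y ∈ D) {v v' : E} (h : ∀ w, b y v w = b y v' w) :
    v = v' := by
  refine sub_eq_zero.1 (hb.nondegenerate y hy _ fun w ↦ ?_)
  simp [h w]

lemma mono (hb : IsMetricOn b D) {D' : Set E} (h : D' ⊆ D) (hD' : IsOpen D') :
    IsMetricOn b D' :=
  ⟨hD', hb.contDiffOn.mono h, fun y hy ↦ hb.symm y (h hy), fun y hy ↦ hb.nondegenerate y (h hy)⟩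

lemma differentiableAt (hb : IsMetricOn b D) (hy : y ∈ D) : DifferentiableAt ℝ b y :=
  (hb.contDiffOn.differentiableOn (by simp)).differentiableAt (hb.isOpen.mem_nhds hy)

lemma fderiv_symm (hb : IsMetricOn b D) (hy : y ∈ D) (u v w : E) :
    fderiv ℝ b y u v w = fderiv ℝ b y u w v := by
  have h1 : (fun z ↦ b z v w) =ᶠ[nhds y] fun z ↦ b z w v :=
    Filter.eventually_of_mem (hb.isOpen.mem_nhds hy) fun z hz ↦ hb.symm z hz v w
  have hd := hb.differentiableAt hy
  have h2 := DFunLike.congr_fun (h1.fderiv_eq (𝕜 := ℝ)) u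
  have hv : DifferentiableAt ℝ (fun _ : E ↦ v) y := differentiableAt_const v
  have hw : DifferentiableAt ℝ (fun _ : E ↦ w) y := differentiableAt_const w
  rw [fderiv_bilin_apply hd hv hw, fderiv_bilin_apply hd hw hv] at h2
  simpa using h2

variable [FiniteDimensional ℝ E]

lemma isInvertible (hb : IsMetricOn b D) (hy : y ∈ D) : (b y).IsInvertible :=
  isInvertible_of_nondegenerate (b y) (hb.nondegenerate y hy)

lemma apply_inverse (hb : IsMetricOn b D) (hy : y ∈ D) (l : E →L[ℝ] ℝ) :
    b y ((b y).inverse l) = l :=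
  ((hb.isInvertible hy).inverse_apply_eq.1 rfl).symm

lemma apply_connection (hb : IsMetricOn b D) (hy : y ∈ D) (u v w : E) :
    b y (connection b y u v) w =
      1 / 2 * (fderiv ℝ b y u v w + fderiv ℝ b y v u w - fderiv ℝ b y w u v) := by
  rw [connection_apply, hb.apply_inverse hy, lowerConnection_apply]

lemma connection_symm (hb : IsMetricOn b D) (hy : y ∈ D) (u v : E) :
    connection b y u v = connection b y v u := by
  refine hb.ext hy fun w ↦ ?_
  rw [hb.apply_connection hy, hb.apply_connection hy, hb.fderiv_symm hy w u v]
  ring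

/-- The Levi-Civita connection is compatible with the metric. -/
lemma fderiv_eq (hb : IsMetricOn b D) (hy : y ∈ D) (u v w : E) :
    fderiv ℝ b y u v w = b y (connection b y u v) w + b y v (connection b y u w) := by
  rw [hb.symm y hy v, hb.apply_connection hy, hb.apply_connection hy, hb.fderiv_symm hy v u w,
    hb.fderiv_symm hy u w v]
  ring

/-- The Levi-Civita connection is the only symmetric connection compatible with the metric. -/
lemma connection_unique (hb : IsMetricOn b D) (hy : y ∈ D) (N : E → E → E)
    (hN : ∀ u v, N u v = N v u)
    (hbN : ∀ u v w, fderiv ℝ b y u v w = b y (N u v) w + b y v (N u w)) (u v : E) :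
    connection b y u v = N u v := by
  refine hb.ext hy fun w ↦ ?_
  rw [hb.apply_connection hy, hbN, hbN, hbN, hN w u, hN w v, hN v u,
    hb.symm y hy u, hb.symm y hy v]
  ring

lemma connection_contDiffOn (hb : IsMetricOn b D) : ContDiffOn ℝ ∞ (connection b) D := by
  have h1 : ContDiffOn ℝ ∞ (fderiv ℝ b) D := hb.contDiffOn.fderiv_of_isOpen hb.isOpen (by simp)
  have h2 : ContDiffOn ℝ ∞ (fun y ↦ (fderiv ℝ b y).flip) D :=
    (flipₗᵢ ℝ E E (E →L[ℝ] ℝ)).toContinuousLinearEquiv.contDiff.comp_contDiffOn h1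
  have h3 : ContDiffOn ℝ ∞ (lowerConnection b) D :=
    ((h1.add h2).sub (contDiffOn_const.clm_comp h2)).const_smul _
  have h4 : ContDiffOn ℝ ∞ (fun y ↦ (b y).inverse) D := fun y hy ↦
    ((hb.isInvertible hy).contDiffAt_map_inverse).comp_contDiffWithinAt y (hb.contDiffOn y hy)
  exact ((compL ℝ E (E →L[ℝ] ℝ) E).contDiff.comp_contDiffOn h4).clm_comp h3

lemma connection_differentiableAt (hb : IsMetricOn b D) (hy : y ∈ D) :
    DifferentiableAt ℝ (connection b) y :=
  (hb.connection_contDiffOn.differentiableOn (by simp)).differentiableAt (hb.isOpen.mem_nhds hy)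

end IsMetricOn

end LocalMetric

/-! ### Curvature and integrability conditions. -/

section Curvature

variable {E : Type*} [NormedAddCommGroup E] [NormedSpace ℝ E]
  {V : Type*} [NormedAddCommGroup V] [NormedSpace ℝ V]
  {b : E → E →L[ℝ] E →L[ℝ] ℝ} {D : Set E} {y : E}

lemma ContDiffOn.differentiableAt_of_isOpen {F : E → V} (hF : ContDiffOn ℝ ∞ F D) (hD : IsOpen D)
    (hy : y ∈ D) : DifferentiableAt ℝ F y :=
  (hF.differentiableOn (by simp)).differentiableAt (hD.mem_nhds hy)

/-- Symmetry of the second derivative, for a function whose first derivative is known. -/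
lemma fderiv_comm_of_eqOn {F : E → V} {Φ : E → E → V} (hF : ContDiffOn ℝ ∞ F D) (hD : IsOpen D)
    (hy : y ∈ D) (hΦ : ∀ w ∈ D, ∀ z, fderiv ℝ F w z = Φ z w) (x z : E) :
    fderiv ℝ (Φ z) y x = fderiv ℝ (Φ x) y z := by
  have hd : DifferentiableAt ℝ (fderiv ℝ F) y :=
    (hF.fderiv_of_isOpen hD (m := ∞) (by simp)).differentiableAt_of_isOpen hD hy
  have key : ∀ x z, fderiv ℝ (Φ z) y x = fderiv ℝ (fderiv ℝ F) y x z := fun x z ↦ by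
    have h1 : Φ z =ᶠ[nhds y] fun w ↦ fderiv ℝ F w z :=
      Filter.eventually_of_mem (hD.mem_nhds hy) fun w hw ↦ (hΦ w hw z).symm
    rw [h1.fderiv_eq, fderiv_lin_apply hd (differentiableAt_const z)]
    simp
  rw [key, key]
  exact ((hF.contDiffAt (hD.mem_nhds hy)).isSymmSndFDerivAt
    (by simpa using (mod_cast le_top : ((2 : ℕ∞) : WithTop ℕ∞) ≤ (⊤ : ℕ∞)))) x z

/-- The curvature operator `R(x, z) v` of the connection of `b`. -/
def curvature (b : E → E →L[ℝ] E →L[ℝ] ℝ) (y x z v : E) : E :=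
  fderiv ℝ (connection b) y x z v - fderiv ℝ (connection b) y z x v
    + connection b y x (connection b y z v) - connection b y z (connection b y x v)

lemma curvature_swap (b : E → E →L[ℝ] E →L[ℝ] ℝ) (y x z v : E) :
    curvature b y x z v = -curvature b y z x v := by
  simp only [curvature]
  abel

namespace IsMetricOn

variable [FiniteDimensional ℝ E]

lemma fderiv_connection_apply (hb : IsMetricOn b D) (hy : y ∈ D) (x z : E) {X : E → E}
    (hX : DifferentiableAt ℝ X y) :
    fderiv ℝ (fun w ↦ connection b w z (X w)) y x =
      fderiv ℝ (connection b) y x z (X y) + connection b y z (fderiv ℝ X y x) := by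
  rw [fderiv_bilin_apply (hb.connection_differentiableAt hy) (differentiableAt_const z) hX]
  simp

lemma differentiableAt_connection_apply (hb : IsMetricOn b D) (hy : y ∈ D) (z : E) {X : E → E}
    (hX : DifferentiableAt ℝ X y) : DifferentiableAt ℝ (fun w ↦ connection b w z (X w)) y :=
  ((hb.connection_differentiableAt hy).clm_apply (differentiableAt_const z)).clm_apply hX

lemma fderiv_connection_symm (hb : IsMetricOn b D) (hy : y ∈ D) (u v w : E) :
    fderiv ℝ (connection b) y u v w = fderiv ℝ (connection b) y u w v := by
  have h1 : (fun z ↦ connection b z v w) =ᶠ[nhds y] fun z ↦ connection b z w v :=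
    Filter.eventually_of_mem (hb.isOpen.mem_nhds hy) fun z hz ↦ hb.connection_symm hz v w
  have h2 := DFunLike.congr_fun (h1.fderiv_eq (𝕜 := ℝ)) u
  rw [hb.fderiv_connection_apply hy _ _ (differentiableAt_const w),
    hb.fderiv_connection_apply hy _ _ (differentiableAt_const v)] at h2
  simpa using h2

/-- The first Bianchi identity. -/
lemma curvature_bianchi (hb : IsMetricOn b D) (hy : y ∈ D) (x z v : E) :
    curvature b y x z v + curvature b y z v x + curvature b y v x z = 0 := by
  simp only [curvature]
  rw [hb.fderiv_connection_symm hy x v z, hb.fderiv_connection_symm hy z v x,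
    hb.fderiv_connection_symm hy v x z, hb.connection_symm hy z v, hb.connection_symm hy x v,
    hb.connection_symm hy z x]
  abel

/-- The curvature operator is skew-adjoint. -/
lemma curvature_skew (hb : IsMetricOn b D) (hy : y ∈ D) (x z v w : E) :
    b y (curvature b y x z v) w + b y v (curvature b y x z w) = 0 := by
  have hd := hb.differentiableAt hy
  -- The identity expresses the symmetry of the mixed second derivatives of the component `b(v, w)`,
  -- with derivatives of `b` rewritten by metric compatibility.
  have hF : ContDiffOn ℝ ∞ (fun p ↦ b p v w) D :=
    (hb.contDiffOn.clm_apply contDiffOn_const).clm_apply contDiffOn_const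
  have hc := fun u : E ↦ differentiableAt_const (𝕜 := ℝ) (x := y) u
  have h := fderiv_comm_of_eqOn
    (Φ := fun z p ↦ b p (connection b p z v) w + b p v (connection b p z w)) hF hb.isOpen hy
    (fun p hp u ↦ by
      rw [fderiv_bilin_apply (hb.differentiableAt hp) (differentiableAt_const v)
        (differentiableAt_const w), hb.fderiv_eq hp]
      simp) x z
  have key : ∀ x z, fderiv ℝ (fun p ↦ b p (connection b p z v) w + b p v (connection b p z w)) y x
      = b y (connection b y x (connection b y z v)) w
        + b y (connection b y z v) (connection b y x w)
        + b y (fderiv ℝ (connection b) y x z v) w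
        + (b y (connection b y x v) (connection b y z w)
        + b y v (connection b y x (connection b y z w))
        + b y v (fderiv ℝ (connection b) y x z w)) := fun x z ↦ by
    rw [fderiv_fun_add ((hd.clm_apply
      (hb.differentiableAt_connection_apply hy z (hc v))).clm_apply (hc w)) ((hd.clm_apply
      (hc v)).clm_apply (hb.differentiableAt_connection_apply hy z (hc w))), add_apply,
      fderiv_bilin_apply hd (hb.differentiableAt_connection_apply hy z (hc v)) (hc w),
      fderiv_bilin_apply hd (hc v) (hb.differentiableAt_connection_apply hy z (hc w)),
      hb.fderiv_connection_apply hy _ _ (hc v), hb.fderiv_connection_apply hy _ _ (hc w),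
      hb.fderiv_eq hy, hb.fderiv_eq hy]
    simp
  rw [key, key] at h
  simp only [curvature, map_add, map_sub, add_apply, sub_apply]
  linear_combination h

/-- The curvature operator kills a parallel field. -/
lemma curvature_parallel (hb : IsMetricOn b D) (hy : y ∈ D) {P : E → E}
    (hP : ContDiffOn ℝ ∞ P D) (hpar : ∀ w ∈ D, ∀ u, fderiv ℝ P w u = -connection b w u (P w))
    (x z : E) : curvature b y x z (P y) = 0 := by
  have hd := hP.differentiableAt_of_isOpen hb.isOpen hy
  have h := fderiv_comm_of_eqOn (Φ := fun z p ↦ -connection b p z (P p)) hP hb.isOpen hy hpar x z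
  simp only [fderiv_fun_neg, neg_apply] at h
  rw [hb.fderiv_connection_apply hy _ _ hd, hb.fderiv_connection_apply hy _ _ hd, hpar y hy,
    hpar y hy] at h
  simp only [map_neg] at h
  simp only [curvature]
  linear_combination (norm := module) (-1 : ℝ) • h

/-- The curvature operator vanishes when one of its first two arguments is a parallel field. -/
lemma curvature_parallel_left (hb : IsMetricOn b D) (hy : y ∈ D) {P : E → E}
    (hP : ContDiffOn ℝ ∞ P D) (hpar : ∀ w ∈ D, ∀ u, fderiv ℝ P w u = -connection b w u (P w))
    (z v : E) : curvature b y (P y) z v = 0 := by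
  -- Since the curvature kills `P`, the Bianchi identity reduces to symmetry of `R(P, z) v` in `z`
  -- and `v`.
  have hsymm : ∀ z v w, b y (curvature b y (P y) z v) w = b y (curvature b y (P y) v z) w := by
    intro z v w
    have h1 := hb.curvature_bianchi hy (P y) z v
    rw [hb.curvature_parallel hy hP hpar, curvature_swap b y v] at h1
    have : curvature b y (P y) z v = curvature b y (P y) v z := by
      linear_combination (norm := module) (1 : ℝ) • h1
    rw [this]
  have hskew : ∀ z v w, b y (curvature b y (P y) z v) w = -b y (curvature b y (P y) z w) v :=
    fun z v w ↦ by
      have := hb.curvature_skew hy (P y) z v w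
      rw [hb.symm y hy v] at this
      linear_combination this
  refine hb.nondegenerate y hy _ fun w ↦ ?_
  -- The trilinear form `b(R(P, z) v, w)` is symmetric in its first two arguments and skew in its
  -- last two. Alternating the two rules six times returns it with the opposite sign, so it
  -- vanishes.
  have e1 := hskew z v w
  have e2 := hsymm z w v
  have e3 := hskew w z v
  have e4 := hsymm w v z
  have e5 := hskew v w z
  have e6 := hsymm v z w
  linarith

/-- The integrability condition of the equation `(∇_u A) v = b(u, v) λ + b(λ, v) u`. -/
lemma curvature_commutator (hb : IsMetricOn b D) (hy : y ∈ D) {A : E → E →L[ℝ] E} {l : E → E}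
    (hA : ContDiffOn ℝ ∞ A D) (hl : ContDiffOn ℝ ∞ l D)
    (hS : ∀ w ∈ D, ∀ u v, fderiv ℝ A w u v =
      -connection b w u (A w v) + A w (connection b w u v) + b w u v • l w + b w (l w) v • u)
    (x z v : E) :
    curvature b y x z (A y v) - A y (curvature b y x z v) =
      b y z v • (fderiv ℝ l y x + connection b y x (l y))
      + b y (fderiv ℝ l y x + connection b y x (l y)) v • z
      - b y x v • (fderiv ℝ l y z + connection b y z (l y))
      - b y (fderiv ℝ l y z + connection b y z (l y)) v • x := by
  have hd := hb.differentiableAt hy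
  have hdA := hA.differentiableAt_of_isOpen hb.isOpen hy
  have hdl := hl.differentiableAt_of_isOpen hb.isOpen hy
  have hc := fun u : E ↦ differentiableAt_const (𝕜 := ℝ) (x := y) u
  have hF : ContDiffOn ℝ ∞ (fun p ↦ A p v) D := hA.clm_apply contDiffOn_const
  -- Equality of the mixed second derivatives of `A v`, with the first derivatives replaced by the
  -- given equation.
  have h := fderiv_comm_of_eqOn (Φ := fun z p ↦ -connection b p z (A p v)
      + A p (connection b p z v) + b p z v • l p + b p (l p) v • z) hF hb.isOpen hy
    (fun p hp u ↦ by
      rw [fderiv_lin_apply (hA.differentiableAt_of_isOpen hb.isOpen hp) (differentiableAt_const v),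
        hS p hp]
      simp) x z
  have key : ∀ x z, fderiv ℝ (fun p ↦ -connection b p z (A p v)
      + A p (connection b p z v) + b p z v • l p + b p (l p) v • z) y x
      = -(fderiv ℝ (connection b) y x z (A y v) + connection b y z (fderiv ℝ A y x v))
        + (fderiv ℝ A y x (connection b y z v) + A y (fderiv ℝ (connection b) y x z v))
        + (fderiv ℝ b y x z v • l y + b y z v • fderiv ℝ l y x)
        + (fderiv ℝ b y x (l y) v + b y (fderiv ℝ l y x) v) • z := fun x z ↦ by
    have d1 : DifferentiableAt ℝ (fun p ↦ connection b p z (A p v)) y :=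
      hb.differentiableAt_connection_apply hy z (hdA.clm_apply (hc v))
    have d2 : DifferentiableAt ℝ (fun p ↦ A p (connection b p z v)) y :=
      hdA.clm_apply (hb.differentiableAt_connection_apply hy z (hc v))
    have d3 : DifferentiableAt ℝ (fun p ↦ b p z v) y := (hd.clm_apply (hc z)).clm_apply (hc v)
    have d4 : DifferentiableAt ℝ (fun p ↦ b p (l p) v) y := (hd.clm_apply hdl).clm_apply (hc v)
    rw [fderiv_fun_add ((d1.fun_neg.fun_add d2).fun_add (d3.fun_smul hdl)) (d4.fun_smul (hc z)),
      fderiv_fun_add (d1.fun_neg.fun_add d2) (d3.fun_smul hdl), fderiv_fun_add d1.fun_neg d2,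
      fderiv_fun_neg, fderiv_fun_smul d3 hdl, fderiv_fun_smul d4 (hc z)]
    simp only [add_apply, neg_apply, smul_apply,
      ContinuousLinearMap.smulRight_apply]
    rw [hb.fderiv_connection_apply hy _ _ (hdA.clm_apply (hc v)), fderiv_lin_apply hdA (hc v),
      fderiv_lin_apply hdA (hb.differentiableAt_connection_apply hy z (hc v)),
      hb.fderiv_connection_apply hy _ _ (hc v), fderiv_bilin_apply hd (hc z) (hc v),
      fderiv_bilin_apply hd hdl (hc v)]
    simp
    abel
  rw [key, key, hS y hy, hS y hy, hS y hy, hS y hy, hb.fderiv_eq hy, hb.fderiv_eq hy,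
    hb.fderiv_eq hy, hb.fderiv_eq hy] at h
  simp only [curvature, map_add, map_sub, map_neg, map_smul, add_apply] at h ⊢
  rw [hb.connection_symm hy z x] at h
  linear_combination (norm := module) (-1 : ℝ) • h

end IsMetricOn

end Curvature

/-! ### The derivative of the determinant. -/

section Determinant

variable {E : Type*} [NormedAddCommGroup E] [NormedSpace ℝ E] [FiniteDimensional ℝ E]

/-- In a basis the Leibniz expansion is a polynomial in the matrix entries. -/
lemma contDiff_det : ContDiff ℝ ∞ (fun C : E →L[ℝ] E ↦ LinearMap.det (C : E →ₗ[ℝ] E)) := by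
  have h : (fun C : E →L[ℝ] E ↦ LinearMap.det (C : E →ₗ[ℝ] E)) = fun C ↦
      ∑ σ : Equiv.Perm (Fin (Module.finrank ℝ E)), (Equiv.Perm.sign σ : ℤ) •
        ∏ i, LinearMap.toContinuousLinearMap ((Module.finBasis ℝ E).coord (σ i))
          (C (Module.finBasis ℝ E i)) := by
    funext C
    rw [← LinearMap.det_toMatrix (Module.finBasis ℝ E), Matrix.det_apply]
    simp [LinearMap.toMatrix_apply, Units.smul_def]
  rw [h]
  refine ContDiff.sum fun σ _ ↦ ContDiff.const_smul _ (contDiff_prod fun i _ ↦ ?_)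
  exact (ContinuousLinearMap.contDiff _).comp (contDiff_id.clm_apply contDiff_const)

/-- Jacobi's formula. -/
lemma fderiv_det (C K : E →L[ℝ] E) :
    fderiv ℝ (fun C : E →L[ℝ] E ↦ LinearMap.det (C : E →ₗ[ℝ] E)) C (C.comp K) =
      LinearMap.det (C : E →ₗ[ℝ] E) * LinearMap.trace ℝ E K := by
  have h1 : HasDerivAt (fun t : ℝ ↦ C + t • C.comp K) (C.comp K) 0 := by
    simpa using ((hasDerivAt_id (0 : ℝ)).smul_const (C.comp K)).const_add C
  have hd := (contDiff_det (E := E)).differentiable (by simp) (C + (0 : ℝ) • C.comp K)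
  have h2 := hd.hasFDerivAt.comp_hasDerivAt 0 h1
  set bs := Module.finBasis ℝ E
  set N := LinearMap.toMatrix bs bs (K : E →ₗ[ℝ] E) with hN
  -- On the line `C + t C K` the determinant is `det C * det (1 + t K)`. Here `q` is what remains of
  -- the polynomial `det (1 + t K)` after its constant and linear terms are removed and `t²` is
  -- divided out; it does not contribute to the derivative at `0`.
  set q := (Matrix.det (1 + (Polynomial.X : Polynomial ℝ) • N.map Polynomial.C)).divX.divX
  have h3 : ∀ t : ℝ, LinearMap.det ((C + t • C.comp K : E →L[ℝ] E) : E →ₗ[ℝ] E) =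
      LinearMap.det (C : E →ₗ[ℝ] E) * (1 + N.trace * t + q.eval t * t ^ 2) := fun t ↦ by
    have : ((C + t • C.comp K : E →L[ℝ] E) : E →ₗ[ℝ] E) =
        (C : E →ₗ[ℝ] E) * (1 + t • (K : E →ₗ[ℝ] E)) := by
      ext v; simp
    rw [this, map_mul, ← Matrix.det_one_add_smul, ← LinearMap.det_toMatrix bs (1 + _)]
    simp [hN, LinearMap.toMatrix_one]
  have h4 : HasDerivAt (fun t : ℝ ↦ LinearMap.det (C : E →ₗ[ℝ] E) *
      (1 + N.trace * t + q.eval t * t ^ 2)) (LinearMap.det (C : E →ₗ[ℝ] E) * N.trace) 0 := by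
    have := ((((hasDerivAt_id (0 : ℝ)).const_mul N.trace).const_add 1).add
      ((q.hasDerivAt 0).mul (hasDerivAt_pow 2 (0 : ℝ)))).const_mul (LinearMap.det (C : E →ₗ[ℝ] E))
    simpa using this
  have h5 := h2.unique (h4.congr_of_eventuallyEq (Filter.Eventually.of_forall h3))
  rw [LinearMap.trace_eq_matrix_trace ℝ bs]
  simpa using h5

end Determinant

/-! ### The potential of a projective change. -/

section Projective

variable {E : Type*} [NormedAddCommGroup E] [NormedSpace ℝ E] [FiniteDimensional ℝ E]
  {a b : E → E →L[ℝ] E →L[ℝ] ℝ} {D : Set E} {y : E}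

/-- The operator relating two metrics: `a (C v, w) = b (v, w)`. -/
def ratio (a b : E → E →L[ℝ] E →L[ℝ] ℝ) (y : E) : E →L[ℝ] E := (a y).inverse.comp (b y)

/-- The potential of the one-form of a projective change of metric from `a` to `b`. -/
def projPotential (a b : E → E →L[ℝ] E →L[ℝ] ℝ) (y : E) : ℝ :=
  (2 * (Module.finrank ℝ E + 1 : ℝ))⁻¹ * Real.log (LinearMap.det (ratio a b y : E →ₗ[ℝ] E))

lemma ratio_apply (ha : IsMetricOn a D) (hy : y ∈ D) (v w : E) :
    a y (ratio a b y v) w = b y v w := by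
  rw [ratio, ContinuousLinearMap.comp_apply, ha.apply_inverse hy]

lemma inverse_contDiffOn (ha : IsMetricOn a D) : ContDiffOn ℝ ∞ (fun y ↦ (a y).inverse) D :=
  fun y hy ↦
    ((ha.isInvertible hy).contDiffAt_map_inverse).comp_contDiffWithinAt y (ha.contDiffOn y hy)

lemma ratio_contDiffOn (ha : IsMetricOn a D) (hb : IsMetricOn b D) :
    ContDiffOn ℝ ∞ (ratio a b) D :=
  (inverse_contDiffOn ha).clm_comp hb.contDiffOn

lemma ratio_injective (ha : IsMetricOn a D) (hb : IsMetricOn b D) (hy : y ∈ D) :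
    Function.Injective (ratio a b y) := by
  refine (injective_iff_map_eq_zero _).2 fun v hv ↦ hb.nondegenerate y hy v fun w ↦ ?_
  rw [← ratio_apply ha hy, hv]
  simp

/-- The derivative of the potential is the one-form of the projective change. -/
lemma hasFDerivAt_projPotential (ha : IsMetricOn a D) (hb : IsMetricOn b D) (hy : y ∈ D)
    {ψ : E →L[ℝ] ℝ}
    (hψ : ∀ u v, connection b y u v = connection a y u v + ψ u • v + ψ v • u) :
    HasFDerivAt (projPotential a b) ψ y := by
  have hinj := ratio_injective ha hb hy
  let e : E ≃ₗ[ℝ] E := LinearEquiv.ofInjectiveEndo (ratio a b y : E →ₗ[ℝ] E) hinj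
  have he : ∀ v, e v = ratio a b y v := fun v ↦ rfl
  have hdet : LinearMap.det (ratio a b y : E →ₗ[ℝ] E) ≠ 0 := e.isUnit_det'.ne_zero
  have hC := (ratio_contDiffOn ha hb).differentiableAt_of_isOpen ha.isOpen hy
  set q := (b y).inverse ψ
  have hq : ∀ w, b y q w = ψ w := fun w ↦ by rw [hb.apply_inverse hy]
  -- Obtained by differentiating `a(C v, w) = b(v, w)` for the ratio `C` and eliminating the
  -- connection of `a` acting on `w`.
  have hDC : ∀ u v, fderiv ℝ (ratio a b) y u v = ratio a b y (connection b y u v)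
      - connection a y u (ratio a b y v) + ψ u • ratio a b y v + b y v u • ratio a b y q := by
    intro u v
    refine ha.ext hy fun w ↦ ?_
    have h1 : (fun z ↦ a z (ratio a b z v) w) =ᶠ[nhds y] fun z ↦ b z v w :=
      Filter.eventually_of_mem (ha.isOpen.mem_nhds hy) fun z hz ↦ ratio_apply ha hz v w
    have h2 := DFunLike.congr_fun (h1.fderiv_eq (𝕜 := ℝ)) u
    rw [fderiv_bilin_apply (ha.differentiableAt hy) (hC.clm_apply (differentiableAt_const v))
      (differentiableAt_const w), fderiv_bilin_apply (hb.differentiableAt hy)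
      (differentiableAt_const v) (differentiableAt_const w),
      fderiv_lin_apply hC (differentiableAt_const v), ha.fderiv_eq hy, hb.fderiv_eq hy,
      ← ratio_apply ha hy (connection b y u v), ← ratio_apply ha hy v (connection b y u w),
      hψ u w] at h2
    simp only [fderiv_fun_const, Pi.zero_apply, zero_apply, map_zero, add_zero, map_add, map_smul,
      smul_eq_mul] at h2
    simp only [map_add, map_sub, map_smul, add_apply, sub_apply, smul_apply, smul_eq_mul,
      ratio_apply ha hy q, hq]
    rw [ratio_apply ha hy v u] at h2
    linear_combination h2
  -- The determinant may be negative; `Real.log` is the logarithm of the absolute value, so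
  -- nonvanishing is enough.
  have hlog : HasFDerivAt (projPotential a b) ((2 * (Module.finrank ℝ E + 1 : ℝ))⁻¹ •
      ((LinearMap.det (ratio a b y : E →ₗ[ℝ] E))⁻¹ •
        (fderiv ℝ (fun C : E →L[ℝ] E ↦ LinearMap.det (C : E →ₗ[ℝ] E)) (ratio a b y)).comp
          (fderiv ℝ (ratio a b) y))) y :=
    ((((contDiff_det (E := E)).differentiable (by simp) (ratio a b y)).hasFDerivAt.comp y
      hC.hasFDerivAt).log hdet).const_mul _
  convert hlog using 1
  ext u
  -- The logarithmic derivative of `det C` is the trace of `K = C⁻¹ ∂_u C`. The conjugated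
  -- connection of `a` has the trace of the original one, so the difference of connections
  -- contributes `(n + 1) ψ(u)`, the scalar term `n ψ(u)` and the rank-one term `ψ(u)`. The total `2
  -- (n + 1) ψ(u)` explains the normalization of the potential.
  let K : E →L[ℝ] E := connection b y u - LinearMap.toContinuousLinearMap
      ((e.symm : E →ₗ[ℝ] E) ∘ₗ (connection a y u : E →ₗ[ℝ] E) ∘ₗ (e : E →ₗ[ℝ] E))
      + ψ u • ContinuousLinearMap.id ℝ E + ((b y).flip u).smulRight q
  have hK : fderiv ℝ (ratio a b) y u = (ratio a b y).comp K := by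
    ext v
    rw [hDC]
    have : ratio a b y (e.symm (connection a y u (e v))) = connection a y u (ratio a b y v) := by
      rw [← he, e.apply_symm_apply, he]
    simp [K, this]
  have htr : LinearMap.trace ℝ E K = 2 * (Module.finrank ℝ E + 1) * ψ u := by
    have h1 : (connection b y u : E →ₗ[ℝ] E) = (connection a y u : E →ₗ[ℝ] E)
        + ψ u • LinearMap.id + (ψ : E →ₗ[ℝ] ℝ).smulRight u := by
      ext v; simp [hψ u v]
    have h2 : (K : E →ₗ[ℝ] E) = (connection b y u : E →ₗ[ℝ] E)
        - (e.symm : E →ₗ[ℝ] E) ∘ₗ (connection a y u : E →ₗ[ℝ] E) ∘ₗ (e : E →ₗ[ℝ] E)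
        + ψ u • LinearMap.id + ((b y).flip u : E →ₗ[ℝ] ℝ).smulRight q := by
      ext v; simp [K]
    have h3 : LinearMap.trace ℝ E ((e.symm : E →ₗ[ℝ] E) ∘ₗ (connection a y u : E →ₗ[ℝ] E)
        ∘ₗ (e : E →ₗ[ℝ] E)) = LinearMap.trace ℝ E (connection a y u : E →ₗ[ℝ] E) := by
      rw [LinearMap.trace_comp_comm', LinearMap.comp_assoc]
      simp
    rw [h2, map_add, map_add, map_sub, h3, h1, map_add, map_add, map_smul, LinearMap.trace_id,
      LinearMap.trace_smulRight, LinearMap.trace_smulRight]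
    simp [hq]
    ring
  have hn : (Module.finrank ℝ E + 1 : ℝ) ≠ 0 := by positivity
  rw [smul_apply, smul_apply, ContinuousLinearMap.comp_apply, hK, fderiv_det, htr]
  simp only [smul_eq_mul]
  field_simp

end Projective

/-! ### Concircular fields and the operator equation under a projective change. -/

section FieldsOnOpenSets

variable {E : Type*} [NormedAddCommGroup E] [NormedSpace ℝ E]
  {a b : E → E →L[ℝ] E →L[ℝ] ℝ} {D : Set E} {y : E} {A : E → E →L[ℝ] E} {P : E → E}

lemma ContDiffOn.clm_pow_apply (hA : ContDiffOn ℝ ∞ A D) (hP : ContDiffOn ℝ ∞ P D) (k : ℕ) :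
    ContDiffOn ℝ ∞ (fun z ↦ (A z ^ k) (P z)) D := by
  induction k with
  | zero => simpa using hP
  | succ k ih => simpa [pow_succ'] using hA.clm_apply ih

/-- Concircular fields are projectively invariant up to a scaling. -/
lemma concircular_projChange {ψ : E →L[ℝ] ℝ} {Ψ : E → ℝ} {X : E → E} {ρ : ℝ}
    (hψ : ∀ u v, connection b y u v = connection a y u v + ψ u • v + ψ v • u)
    (hΨ : HasFDerivAt Ψ ψ y) (hX : DifferentiableAt ℝ X y)
    (hρ : ∀ u, fderiv ℝ X y u + connection a y u (X y) = ρ • u) (u : E) :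
    fderiv ℝ (fun z ↦ Real.exp (-Ψ z) • X z) y u + connection b y u (Real.exp (-Ψ y) • X y) =
      (Real.exp (-Ψ y) * (ρ + ψ (X y))) • u := by
  have h := (hΨ.fun_neg.exp).smul hX.hasFDerivAt
  -- The term `-ψ(u) X` produced by the scaling cancels the `ψ(u) X` in the new connection; only
  -- `ψ(X) u` survives.
  have h1 : fderiv ℝ (fun z ↦ Real.exp (-Ψ z) • X z) y u =
      Real.exp (-Ψ y) • fderiv ℝ X y u - (Real.exp (-Ψ y) * ψ u) • X y := by
    rw [HasFDerivAt.fderiv (f := fun z ↦ Real.exp (-Ψ z) • X z) h]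
    simp
    module
  rw [h1, map_smul, hψ]
  have := congrArg (Real.exp (-Ψ y) • ·) (hρ u)
  simp only [smul_add] at this
  linear_combination (norm := module) this

end FieldsOnOpenSets

section ProjectiveFields

variable {E : Type*} [NormedAddCommGroup E] [NormedSpace ℝ E] [FiniteDimensional ℝ E]
  {a b : E → E →L[ℝ] E →L[ℝ] ℝ} {D : Set E} {y : E}

lemma projPotential_contDiffOn (ha : IsMetricOn a D) (hb : IsMetricOn b D) :
    ContDiffOn ℝ ∞ (projPotential a b) D := by
  refine contDiffOn_const.mul (ContDiffOn.log
    ((contDiff_det (E := E)).comp_contDiffOn (ratio_contDiffOn ha hb)) fun y hy ↦ ?_)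
  exact (LinearEquiv.ofInjectiveEndo (ratio a b y : E →ₗ[ℝ] E)
    (ratio_injective ha hb hy)).isUnit_det'.ne_zero

/-- The equation satisfied by the operator relating two projectively equivalent metrics. -/
lemma fderiv_ratio_projChange (ha : IsMetricOn a D) (hb : IsMetricOn b D) (hy : y ∈ D)
    {ψ : E →L[ℝ] ℝ} {Ψ : E → ℝ} {A : E → E →L[ℝ] E} {l : E}
    (hψ : ∀ u v, connection b y u v = connection a y u v + ψ u • v + ψ v • u)
    (hΨ : HasFDerivAt Ψ ψ y) (hA : DifferentiableAt ℝ A y)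
    (hAb : ∀ z ∈ D, ∀ v w, a z (A z v) w = Real.exp (-2 * Ψ z) * b z v w)
    (hl : ∀ w, a y l w = Real.exp (-2 * Ψ y) * ψ w) (u v : E) :
    fderiv ℝ A y u v = -connection b y u (A y v) + A y (connection b y u v)
      + b y u v • l + b y l v • u := by
  refine ha.ext hy fun w ↦ ?_
  have hv : DifferentiableAt ℝ (fun _ : E ↦ v) y := differentiableAt_const v
  have hw : DifferentiableAt ℝ (fun _ : E ↦ w) y := differentiableAt_const w
  have h1 : (fun z ↦ a z (A z v) w) =ᶠ[nhds y] fun z ↦ Real.exp (-2 * Ψ z) * b z v w :=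
    Filter.eventually_of_mem (ha.isOpen.mem_nhds hy) fun z hz ↦ hAb z hz v w
  have h2 := DFunLike.congr_fun (h1.fderiv_eq (𝕜 := ℝ)) u
  -- The exponent `-2` is forced: its derivative cancels the two terms in `ψ(u)`, one from the
  -- connection acting on `w` and one from its action on `A v`. The surviving `ψ(w)` and `ψ(A v) u`
  -- become the terms with `l`.
  have hE : HasFDerivAt (fun z ↦ Real.exp (-2 * Ψ z)) (Real.exp (-2 * Ψ y) • (-2 : ℝ) • ψ) y :=
    (hΨ.const_mul (-2)).exp
  rw [fderiv_bilin_apply (ha.differentiableAt hy) (hA.clm_apply hv) hw, fderiv_lin_apply hA hv,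
    fderiv_fun_mul hE.differentiableAt (((hb.differentiableAt hy).clm_apply hv).clm_apply hw),
    hE.fderiv, ha.fderiv_eq hy, add_apply, smul_apply, smul_apply,
    fderiv_bilin_apply (hb.differentiableAt hy) hv hw, hb.fderiv_eq hy] at h2
  simp only [fderiv_fun_const, Pi.zero_apply, zero_apply, map_zero, add_zero, smul_apply,
    smul_eq_mul] at h2
  have e1 : ∀ v w, Real.exp (-2 * Ψ y) * b y v w = a y (A y v) w := fun v w ↦ (hAb y hy v w).symm
  have e2 : b y l v = ψ (A y v) := by
    have hne := (Real.exp_pos (-2 * Ψ y)).ne'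
    refine mul_left_cancel₀ hne ?_
    rw [hb.symm y hy, e1, ha.symm y hy, hl]
  have e3 := e1 (connection b y u v) w
  have e4 := e1 v (connection b y u w)
  have e5 := e1 v w
  have e6 := e1 v u
  have e7 := hl w
  have e8 := hψ u w
  have e9 := hψ u (A y v)
  rw [e8] at e4
  rw [e9, e2, hb.symm y hy u v]
  simp only [map_add, map_neg, map_smul, add_apply, neg_apply, smul_apply, smul_eq_mul] at e4 ⊢
  rw [e8] at h2
  simp only [map_add, map_smul, smul_eq_mul] at h2
  rw [e7]
  linear_combination h2 + e3 + e4 - 2 * ψ u * e5 - ψ w * e6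

end ProjectiveFields

/-! ### Linear algebra of a self-adjoint operator. -/

section Algebra

variable {E : Type*} [NormedAddCommGroup E] [NormedSpace ℝ E] {B : E →L[ℝ] E →L[ℝ] ℝ}

/-- `P` may be isotropic, so nothing is divided by `B(P, P)`. For `x` orthogonal to `P`, setting `v
= x` and pairing with `x` gives `2 B(z, x) B(N P, x) = 0`; hence `N P` is a multiple of `P`. Setting
`v = Y` with `B(P, Y) = 1` then determines every `N z`. -/
lemma exists_eq_smul_of_bilin_identity (hsymm : ∀ v w, B v w = B w v)
    (hnd : ∀ v, (∀ w, B v w = 0) → v = 0) {N : E → E} {P : E} (hP : P ≠ 0)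
    (h : ∀ z v, B z v • N P + B (N P) v • z = B P v • N z + B (N z) v • P) :
    ∃ μ : ℝ, ∀ u, N u = μ • u := by
  obtain ⟨w, hw⟩ : ∃ w, B P w ≠ 0 := by
    by_contra! hc
    exact hP (hnd P hc)
  obtain ⟨Y, hY⟩ : ∃ Y, B P Y = 1 := ⟨(B P w)⁻¹ • w, by simp [hw]⟩
  have h1 : ∀ x, B P x = 0 → B (N P) x = 0 := fun x hx ↦ by
    by_cases hx0 : x = 0
    · simp [hx0]
    obtain ⟨z, hz⟩ : ∃ z, B x z ≠ 0 := by
      by_contra! hc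
      exact hx0 (hnd x hc)
    have h2 := congrArg (fun t ↦ B t x) (h z x)
    simp only [map_add, map_smul, add_apply, smul_apply, smul_eq_mul, hx] at h2
    rw [hsymm z x] at h2
    have h3 : B x z * B (N P) x = 0 := by linarith
    exact (mul_eq_zero.1 h3).resolve_left hz
  have h2 : N P = B (N P) Y • P := by
    refine sub_eq_zero.1 (hnd _ fun x ↦ ?_)
    have h3 := h1 (x - B P x • Y) (by simp [hY])
    simp only [map_sub, map_smul, sub_apply, smul_apply, smul_eq_mul] at h3 ⊢
    linear_combination h3
  refine ⟨B (N P) Y, fun z ↦ ?_⟩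
  have h3 := h z Y
  set μ := B (N P) Y
  rw [hY, h2] at h3
  have h4 := congrArg (fun t ↦ B t Y) h3
  simp only [map_add, map_smul, add_apply, smul_apply, smul_eq_mul, hY] at h4
  have h5 : B (N z) Y = B z Y * μ := by linarith
  rw [h5] at h3
  linear_combination (norm := module) -h3

/-- Here `d k` stands for the covariant derivative of `A^k P` along `u`, for parallel `P`, and the
recursion is the Leibniz rule. Self-adjointness moves each `A` to the left argument, where only
vanishing moments of order below `m` occur. -/
lemma bilin_chain_left {A : E →L[ℝ] E} (hA : ∀ v w, B (A v) w = B v (A w)) {l P u : E}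
    {d : ℕ → E} (hd0 : d 0 = 0)
    (hd : ∀ k, d (k + 1) = A (d k) + B u ((A ^ k) P) • l + B l ((A ^ k) P) • u) {m : ℕ}
    (hlP : ∀ j < m, B l ((A ^ j) P) = 0) (hll : ∀ j < m, B l ((A ^ j) l) = 0)
    (hsymm : ∀ v w, B v w = B w v) :
    ∀ k j, j + k ≤ m → B ((A ^ j) l) (d k) = 0 := by
  intro k
  induction k with
  | zero => simp [hd0]
  | succ k ih =>
    intro j hj
    have h1 := ih (j + 1) (by omega)
    rw [pow_succ', mul_apply_eq_comp, hA] at h1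
    rw [hd, map_add, map_add, map_smul, map_smul, h1, hlP k (by omega), hsymm _ l,
      hll j (by omega)]
    simp

/-- Unrolling `d (k + 1)` gives a sum over `i ≤ k` of `B(u, A^i P) B(l, A^{m-i} P) + B(l, A^i P)
B(u, A^{m-i} P)`. The first term survives only for `i = 0`, the second only for `i = m`; the latter
occurs exactly when `k = m`, which doubles the result. -/
lemma bilin_chain_right {A : E →L[ℝ] E} (hA : ∀ v w, B (A v) w = B v (A w)) {l P u : E}
    {d : ℕ → E} (hd0 : d 0 = 0)
    (hd : ∀ k, d (k + 1) = A (d k) + B u ((A ^ k) P) • l + B l ((A ^ k) P) • u) {m : ℕ}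
    (hlP : ∀ j < m, B l ((A ^ j) P) = 0) (hsymm : ∀ v w, B v w = B w v) :
    ∀ k j, j + k = m → B ((A ^ j) P) (d (k + 1)) =
      B l ((A ^ m) P) * B u P * (1 + if k = m then 1 else 0) := by
  intro k
  induction k with
  | zero =>
    intro j hj
    obtain rfl : j = m := by omega
    rw [hd, hd0, map_zero, map_add, map_add, map_smul, map_smul, map_zero, hsymm _ l, hsymm _ u]
    by_cases hj0 : 0 = j
    · subst hj0
      simp
      ring
    · have := hlP 0 (by omega)
      simp only [pow_zero, one_apply_eq_self] at this
      simp [hj0, this]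
      ring
  | succ k ih =>
    intro j hj
    have h1 := ih (j + 1) (by omega)
    rw [pow_succ', mul_apply_eq_comp, hA, if_neg (by omega)] at h1
    rw [hd (k + 1), map_add, map_add, map_smul, map_smul, h1, hsymm _ l, hlP j (by omega),
      hsymm _ u]
    by_cases hk : k + 1 = m
    · obtain rfl : j = 0 := by omega
      simp [hk]
      ring
    · rw [hlP (k + 1) (by omega)]
      simp [hk]

/-- If all the moments `B (l, A ^ m P)` of an injective operator vanish, then the preimage of `P`
is orthogonal to `l`. -/
lemma exists_preimage_orthogonal [FiniteDimensional ℝ E] {A : E →L[ℝ] E}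
    (hA : Function.Injective A) {l P : E} (h : ∀ m, B l ((A ^ m) P) = 0) :
    ∃ w, A w = P ∧ B l w = 0 := by
  let S : Submodule ℝ E := Submodule.span ℝ (Set.range fun m ↦ (A ^ m) P)
  have hS : ∀ w ∈ S, B l w = 0 := fun w hw ↦ by
    have : S ≤ LinearMap.ker (B l : E →ₗ[ℝ] ℝ) := by
      refine Submodule.span_le.2 ?_
      rintro _ ⟨m, rfl⟩
      exact h m
    exact this hw
  have hAS : ∀ w ∈ S, (A : E →ₗ[ℝ] E) w ∈ S := fun w hw ↦ by
    have : S ≤ S.comap (A : E →ₗ[ℝ] E) := by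
      refine Submodule.span_le.2 ?_
      rintro _ ⟨m, rfl⟩
      refine Submodule.subset_span ⟨m + 1, ?_⟩
      simp [pow_succ']
    exact this hw
  -- An injective endomorphism of the finite-dimensional invariant subspace `S` is surjective on it,
  -- so the preimage of `P` can be taken inside `S`.
  have hinj : Function.Injective ((A : E →ₗ[ℝ] E).restrict hAS) := fun v w hvw ↦
    Subtype.ext (hA (congrArg Subtype.val hvw))
  obtain ⟨w, hw⟩ := LinearMap.injective_iff_surjective.1 hinj
    ⟨P, Submodule.subset_span ⟨0, by simp⟩⟩
  exact ⟨w, congrArg Subtype.val hw, hS w w.2⟩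

end Algebra

/-! ### Consequences of a parallel field. -/

section ParallelFields

variable {E : Type*} [NormedAddCommGroup E] [NormedSpace ℝ E] [FiniteDimensional ℝ E]
  {b : E → E →L[ℝ] E →L[ℝ] ℝ} {D : Set E} {y : E} {A : E → E →L[ℝ] E} {l P : E → E}

/-- In the presence of a parallel field `P`, the vector field `l` of the equation
`(∇_u A) v = b(u, v) l + b(l, v) u` is concircular. -/
lemma IsMetricOn.exists_covDeriv_eq_smul (hb : IsMetricOn b D) (hy : y ∈ D)
    (hA : ContDiffOn ℝ ∞ A D) (hl : ContDiffOn ℝ ∞ l D)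
    (hS : ∀ w ∈ D, ∀ u v, fderiv ℝ A w u v =
      -connection b w u (A w v) + A w (connection b w u v) + b w u v • l w + b w (l w) v • u)
    (hP : ContDiffOn ℝ ∞ P D) (hpar : ∀ w ∈ D, ∀ u, fderiv ℝ P w u = -connection b w u (P w))
    (hP0 : P y ≠ 0) :
    ∃ μ : ℝ, ∀ u, fderiv ℝ l y u + connection b y u (l y) = μ • u := by
  refine exists_eq_smul_of_bilin_identity (hb.symm y hy) (hb.nondegenerate y hy) hP0 fun z v ↦ ?_
  -- With `P` in the first slot both curvature terms vanish, leaving a purely algebraic identity for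
  -- the covariant derivative of `l`.
  have h := hb.curvature_commutator hy hA hl hS (P y) z v
  rw [hb.curvature_parallel_left hy hP hpar, hb.curvature_parallel_left hy hP hpar, map_zero] at h
  linear_combination (norm := module) -h

lemma IsMetricOn.fderiv_apply_apply (hb : IsMetricOn b D) (hy : y ∈ D) {X Y : E → E}
    (hX : DifferentiableAt ℝ X y) (hY : DifferentiableAt ℝ Y y) (u : E) :
    fderiv ℝ (fun z ↦ b z (X z) (Y z)) y u = b y (fderiv ℝ X y u + connection b y u (X y)) (Y y)
      + b y (X y) (fderiv ℝ Y y u + connection b y u (Y y)) := by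
  rw [fderiv_bilin_apply (hb.differentiableAt hy) hX hY, hb.fderiv_eq hy]
  simp only [map_add, add_apply]
  ring

/-- The covariant derivative of `2 G A P - F l` with `G = b(l, A ^ m P)` and
`F = b(A ^ (m + 1) P, P)`, for parallel fields `l` and `P`. -/
lemma IsMetricOn.covDeriv_combination (hb : IsMetricOn b D) (hy : y ∈ D)
    (hA : ContDiffOn ℝ ∞ A D) (hl : ContDiffOn ℝ ∞ l D) (hP : ContDiffOn ℝ ∞ P D)
    (hsa : ∀ v w, b y (A y v) w = b y v (A y w))
    (hS : ∀ w ∈ D, ∀ u v, fderiv ℝ A w u v =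
      -connection b w u (A w v) + A w (connection b w u v) + b w u v • l w + b w (l w) v • u)
    (hPpar : ∀ u, fderiv ℝ P y u + connection b y u (P y) = 0)
    (hlpar : ∀ u, fderiv ℝ l y u + connection b y u (l y) = 0) {m : ℕ}
    (hlP : ∀ j < m, b y (l y) ((A y ^ j) (P y)) = 0)
    (hll : ∀ j < m, b y (l y) ((A y ^ j) (l y)) = 0) (u : E) :
    fderiv ℝ (fun z ↦ (2 * b z (l z) ((A z ^ m) (P z))) • A z (P z)
        - b z ((A z ^ (m + 1)) (P z)) (P z) • l z) y u
      + connection b y u ((2 * b y (l y) ((A y ^ m) (P y))) • A y (P y)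
        - b y ((A y ^ (m + 1)) (P y)) (P y) • l y) =
    (2 * b y (l y) ((A y ^ m) (P y)) * b y (l y) (P y)) • u := by
  have hdb := hb.differentiableAt hy
  have hdA := hA.differentiableAt_of_isOpen hb.isOpen hy
  have hdl := hl.differentiableAt_of_isOpen hb.isOpen hy
  have hdP := hP.differentiableAt_of_isOpen hb.isOpen hy
  have hdQ := fun k ↦ (hA.clm_pow_apply hP k).differentiableAt_of_isOpen hb.isOpen hy
  set d : ℕ → E := fun k ↦ fderiv ℝ (fun z ↦ (A z ^ k) (P z)) y u
    + connection b y u ((A y ^ k) (P y)) with hd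
  have hd0 : d 0 = 0 := by simpa [hd] using hPpar u
  have hds : ∀ k, d (k + 1) = A y (d k) + b y u ((A y ^ k) (P y)) • l y
      + b y (l y) ((A y ^ k) (P y)) • u := fun k ↦ by
    have : (fun z ↦ (A z ^ (k + 1)) (P z)) = fun z ↦ A z ((A z ^ k) (P z)) := by
      funext z; simp [pow_succ']
    simp only [hd]
    rw [this, fderiv_lin_apply hdA (hdQ k), hS y hy, pow_succ', mul_apply_eq_comp,
      map_add]
    abel
  have hsymm := hb.symm y hy
  -- With `j = 0` and `k = m` these say that `G` is constant and that `F` has derivative `2 G b(u,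
  -- P)`, the factor `2` being the doubled case `k = m`. The derivative of `F l` therefore cancels
  -- the `l`-term in that of `2 G A P`.
  have h1 := bilin_chain_left hsa hd0 hds hlP hll hsymm m 0 (by omega)
  have h2 := bilin_chain_right hsa hd0 hds hlP hsymm m 0 (by omega)
  simp only [pow_zero, one_apply_eq_self, if_true] at h1 h2
  have hG : fderiv ℝ (fun z ↦ b z (l z) ((A z ^ m) (P z))) y u = 0 := by
    rw [hb.fderiv_apply_apply hy hdl (hdQ m), hlpar, map_zero, zero_apply, zero_add]
    exact h1
  have hF : fderiv ℝ (fun z ↦ b z ((A z ^ (m + 1)) (P z)) (P z)) y u =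
      2 * b y (l y) ((A y ^ m) (P y)) * b y u (P y) := by
    rw [hb.fderiv_apply_apply hy (hdQ (m + 1)) hdP, hPpar, hsymm, map_zero, add_zero]
    rw [← hd] at *
    rw [h2]
    ring
  have dG : DifferentiableAt ℝ (fun z ↦ b z (l z) ((A z ^ m) (P z))) y :=
    (hdb.clm_apply hdl).clm_apply (hdQ m)
  have dF : DifferentiableAt ℝ (fun z ↦ b z ((A z ^ (m + 1)) (P z)) (P z)) y :=
    (hdb.clm_apply (hdQ (m + 1))).clm_apply hdP
  rw [fderiv_fun_sub ((dG.const_mul 2).fun_smul (hdA.clm_apply hdP)) (dF.fun_smul hdl),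
    fderiv_fun_smul (dG.const_mul 2) (hdA.clm_apply hdP), fderiv_fun_smul dF hdl,
    fderiv_const_mul dG]
  simp only [add_apply, sub_apply, smul_apply, ContinuousLinearMap.smulRight_apply, hG, hF]
  rw [fderiv_lin_apply hdA hdP, hS y hy]
  have e1 := hPpar u
  have e2 := hlpar u
  rw [eq_neg_of_add_eq_zero_left e1, eq_neg_of_add_eq_zero_left e2]
  simp only [map_sub, map_smul, map_neg, smul_zero, zero_smul]
  module

end ParallelFields

/-! ### From eigenvectors to a one-form. -/

section Polarization

variable {E : Type*} [NormedAddCommGroup E] [NormedSpace ℝ E] [FiniteDimensional ℝ E]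

/-- A symmetric bilinear map for which every vector is an eigenvector has the form
`(u, v) ↦ ψ u • v + ψ v • u`. -/
lemma exists_oneForm_of_forall_eq_smul (T : E →L[ℝ] E →L[ℝ] E) (hT : ∀ u v, T u v = T v u)
    (h : ∀ u, u ≠ 0 → ∃ κ : ℝ, T u u = κ • u) :
    ∃ ψ : E →L[ℝ] ℝ, ∀ u v, T u v = ψ u • v + ψ v • u := by
  -- The eigenvalue at `u = 0` is arbitrary; fixing it as `0` makes `κ` homogeneous.
  have h' : ∀ u, ∃ κ : ℝ, T u u = κ • u ∧ (u = 0 → κ = 0) := fun u ↦ by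
    by_cases hu : u = 0
    · exact ⟨0, by simp [hu], fun _ ↦ rfl⟩
    · obtain ⟨κ, hκ⟩ := h u hu
      exact ⟨κ, hκ, fun h ↦ absurd h hu⟩
  choose κ hκ hκ0 using h'
  have hsmul : ∀ (c : ℝ) u, κ (c • u) = c * κ u := fun c u ↦ by
    by_cases hcu : c • u = 0
    · rw [hκ0 _ hcu]
      rcases smul_eq_zero.1 hcu with rfl | hu
      · simp
      · simp [hκ0 u hu]
    · have h1 := hκ (c • u)
      simp only [map_smul, smul_apply, hκ u, smul_smul] at h1
      have hu : u ≠ 0 := fun h ↦ hcu (by simp [h])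
      have hc : c ≠ 0 := fun h ↦ hcu (by simp [h])
      have h2 := smul_left_injective ℝ hu h1
      refine mul_left_cancel₀ hc ?_
      linarith
  have hadd : ∀ u v, κ (u + v) = κ u + κ v := fun u v ↦ by
    by_cases hli : LinearIndependent ℝ ![u, v]
    · have h1 := hκ (u + v)
      -- Adding the relations for `u + v` and `u - v` eliminates `T u v`; comparing coefficients of
      -- the independent vectors gives additivity.
      have h2 := hκ (u - v)
      simp only [map_add, map_sub, add_apply, sub_apply, hκ u, hκ v, hT v u] at h1 h2
      have h3 : (κ (u + v) + κ (u - v) - 2 * κ u) • u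
          + (κ (u + v) - κ (u - v) - 2 * κ v) • v = 0 := by
        linear_combination (norm := module) -h1 - h2
      obtain ⟨h4, h5⟩ := LinearIndependent.pair_iff.1 hli _ _ h3
      linarith
    · rw [LinearIndependent.pair_iff] at hli
      push Not at hli
      obtain ⟨s, t, hst, hne⟩ := hli
      by_cases hs : s = 0
      · have ht := hne hs
        have hv : v = 0 := by simpa [hs, ht] using hst
        simp [hv, hκ0 0 rfl]
      · have hu : u = (-(s⁻¹ * t)) • v := by
          have := congrArg (s⁻¹ • ·) hst
          simp only [smul_add, smul_smul, inv_mul_cancel₀ hs, one_smul, smul_zero] at this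
          rw [neg_smul]
          exact eq_neg_of_add_eq_zero_left this
        have huv : u + v = (-(s⁻¹ * t) + 1) • v := by rw [add_smul, ← hu, one_smul]
        rw [huv, hsmul, hu, hsmul]
        ring
  let L : E →ₗ[ℝ] ℝ := { toFun := κ, map_add' := hadd, map_smul' := hsmul }
  refine ⟨(1 / 2 : ℝ) • LinearMap.toContinuousLinearMap L, fun u v ↦ ?_⟩
  have h1 := hκ (u + v)
  simp only [map_add, add_apply, hκ u, hκ v, hT v u, hadd] at h1
  have h2 : (2 : ℝ) • T u v = κ u • v + κ v • u := by
    linear_combination (norm := module) h1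
  have h3 : T u v = (1 / 2 : ℝ) • (κ u • v + κ v • u) := by rw [← h2, smul_smul]; norm_num
  rw [h3]
  simp [L, smul_smul]

end Polarization

/-! ### Christoffel symbols under a change of coordinates. -/

section ChangeOfCoordinates

variable {E : Type*} [NormedAddCommGroup E] [NormedSpace ℝ E] [FiniteDimensional ℝ E]
  {b b' : E → E →L[ℝ] E →L[ℝ] ℝ} {D D' O : Set E} {y : E} {τ : E → E}

/-- The transformation law of the Christoffel symbols. -/
lemma connection_transform (hb : IsMetricOn b D) (hb' : IsMetricOn b' D') (hO : IsOpen O)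
    (hOD : O ⊆ D) (hτ : ContDiffOn ℝ ∞ τ O) (hτD : Set.MapsTo τ O D')
    (h : ∀ z ∈ O, ∀ v w, b z v w = b' (τ z) (fderiv ℝ τ z v) (fderiv ℝ τ z w)) (hy : y ∈ O)
    (u v : E) :
    fderiv ℝ τ y (connection b y u v) =
      connection b' (τ y) (fderiv ℝ τ y u) (fderiv ℝ τ y v) + fderiv ℝ (fderiv ℝ τ) y u v := by
  have hd2 : DifferentiableAt ℝ (fderiv ℝ τ) y :=
    (hτ.fderiv_of_isOpen hO (m := ∞) (by simp)).differentiableAt_of_isOpen hO hy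
  have hd := hτ.differentiableAt_of_isOpen hO hy
  have hinj : Function.Injective (fderiv ℝ τ y : E →ₗ[ℝ] E) := by
    refine (injective_iff_map_eq_zero _).2 fun v hv ↦ hb.nondegenerate y (hOD hy) v fun w ↦ ?_
    rw [h y hy, show fderiv ℝ τ y v = 0 from hv]
    simp
  have hsurj := LinearMap.injective_iff_surjective.1 hinj
  choose S hS using hsurj
  have hS' : ∀ w, fderiv ℝ τ y (S w) = w := hS
  have hsymm2 : ∀ u v, fderiv ℝ (fderiv ℝ τ) y u v = fderiv ℝ (fderiv ℝ τ) y v u :=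
    fun u v ↦ ((hτ.contDiffAt (hO.mem_nhds hy)).isSymmSndFDerivAt
      (by simpa using (mod_cast le_top : ((2 : ℕ∞) : WithTop ℕ∞) ≤ (⊤ : ℕ∞)))) u v
  -- The transformed symbols, pulled back by the inverse `S` of the Jacobian, are symmetric and
  -- compatible with `b`, so uniqueness identifies them.
  rw [hb.connection_unique (hOD hy) (fun u v ↦ S (connection b' (τ y) (fderiv ℝ τ y u)
    (fderiv ℝ τ y v) + fderiv ℝ (fderiv ℝ τ) y u v)) ?_ ?_, hS']
  · intro u v
    rw [hb'.connection_symm (hτD hy), hsymm2]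
  · intro u v w
    have hv : DifferentiableAt ℝ (fun _ : E ↦ v) y := differentiableAt_const v
    have hw : DifferentiableAt ℝ (fun _ : E ↦ w) y := differentiableAt_const w
    have hb'd := hb'.differentiableAt (hτD hy)
    have h1 : (fun z ↦ b z v w) =ᶠ[nhds y] fun z ↦
        b' (τ z) (fderiv ℝ τ z v) (fderiv ℝ τ z w) :=
      Filter.eventually_of_mem (hO.mem_nhds hy) fun z hz ↦ h z hz v w
    have h2 := DFunLike.congr_fun (h1.fderiv_eq (𝕜 := ℝ)) u
    rw [fderiv_bilin_apply (hb.differentiableAt (hOD hy)) hv hw,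
      fderiv_bilin_apply (c := fun z ↦ b' (τ z)) (hb'd.comp y hd) (hd2.clm_apply hv)
        (hd2.clm_apply hw), fderiv_lin_apply hd2 hv, fderiv_lin_apply hd2 hw,
      show (fun z ↦ b' (τ z)) = b' ∘ τ from rfl, fderiv_comp y hb'd hd,
      ContinuousLinearMap.comp_apply, hb'.fderiv_eq (hτD hy)] at h2
    simp only [fderiv_fun_const, Pi.zero_apply, zero_apply, map_zero, add_zero] at h2
    rw [h y hy, h y hy, hS', hS', h2]
    simp only [map_add, add_apply]
    ring

end ChangeOfCoordinates

/-! ### Differential equations for geodesics and parallel fields. -/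

section Geodesics

variable {E : Type*} [NormedAddCommGroup E] [NormedSpace ℝ E] [FiniteDimensional ℝ E]
  {b : E → E →L[ℝ] E →L[ℝ] ℝ} {D : Set E} {y : E}

/-- Existence of geodesics with prescribed initial velocity. -/
lemma IsMetricOn.exists_geodesic (hb : IsMetricOn b D) (hy : y ∈ D) {u : E} (hu : u ≠ 0) :
    ∃ ε > (0 : ℝ), ∃ x : ℝ → E, ContDiffOn ℝ ∞ x (Set.Ioo (-ε) ε) ∧
      (∀ t ∈ Set.Ioo (-ε) ε, x t ∈ D) ∧ x 0 = y ∧ deriv x 0 = u ∧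
      (∀ t ∈ Set.Ioo (-ε) ε, deriv x t ≠ 0) ∧
      ∀ t ∈ Set.Ioo (-ε) ε,
        deriv (deriv x) t + connection b (x t) (deriv x t) (deriv x t) = 0 := by
  let F : E × E → E × E := fun z ↦ (z.2, -connection b z.1 z.2 z.2)
  -- Zero velocities are excluded from the phase space, so staying in `O` already makes the curve
  -- regular.
  let O : Set (E × E) := D ×ˢ {0}ᶜ
  have hO : IsOpen O := hb.isOpen.prod isOpen_compl_singleton
  have hF : ContDiffOn ℝ ∞ F O := by
    have h1 : ContDiffOn ℝ ∞ (fun z : E × E ↦ connection b z.1) O :=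
      hb.connection_contDiffOn.comp contDiffOn_fst fun z hz ↦ hz.1
    exact contDiffOn_snd.prodMk ((h1.clm_apply contDiffOn_snd).clm_apply contDiffOn_snd).neg
  have hyO : (y, u) ∈ O := ⟨hy, hu⟩
  obtain ⟨α, hα0, δ, hδ, hα⟩ := ((hF.contDiffAt (hO.mem_nhds hyO)).of_le
    (by simp)).exists_forall_mem_closedBall_exists_eq_forall_mem_Ioo_hasDerivAt₀ 0
  simp only [zero_sub, zero_add] at hα
  have hcont : ContinuousAt α 0 := (hα 0 ⟨by linarith, hδ⟩).continuousAt
  have hmem : ∀ᶠ t in nhds (0 : ℝ), α t ∈ O :=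
    hcont.preimage_mem_nhds (hO.mem_nhds (by rwa [hα0]))
  obtain ⟨r, hr, hrO⟩ := Metric.eventually_nhds_iff_ball.1 hmem
  -- Halving places the closed interval inside both the existence interval and the ball, as the
  -- smoothness bootstrap on `Icc` requires.
  set ε := min δ r / 2 with hε
  have hε0 : 0 < ε := by positivity
  have hεδ : ε < δ := by have := min_le_left δ r; linarith
  have hεr : ε < r := by have := min_le_right δ r; linarith
  have hαI : ∀ t ∈ Set.Icc (-ε) ε, HasDerivAt α (F (α t)) t := fun t ht ↦
    hα t ⟨by linarith [ht.1], by linarith [ht.2]⟩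
  have hOI : ∀ t ∈ Set.Icc (-ε) ε, α t ∈ O := fun t ht ↦ hrO t (by
    rw [Metric.mem_ball, dist_zero_right, Real.norm_eq_abs, abs_lt]
    exact ⟨by linarith [ht.1], by linarith [ht.2]⟩)
  have hαs : ContDiffOn ℝ ∞ α (Set.Icc (-ε) ε) := by
    refine ODE.contDiffOn_enat_Icc_of_hasDerivWithinAt (n := ⊤) (f := fun _ ↦ F) (u := O) ?_
      (fun t ht ↦ (hαI t ht).hasDerivWithinAt) hOI
    exact hF.comp contDiffOn_snd fun z hz ↦ hz.2
  have hsub := Set.Ioo_subset_Icc_self (a := -ε) (b := ε)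
  have h1 : ∀ t ∈ Set.Icc (-ε) ε, deriv (fun s ↦ (α s).1) t = (α t).2 := fun t ht ↦
    ((ContinuousLinearMap.fst ℝ E E).hasFDerivAt.comp_hasDerivAt t (hαI t ht)).deriv
  have h2 : ∀ t ∈ Set.Ioo (-ε) ε, deriv (deriv fun s ↦ (α s).1) t =
      -connection b (α t).1 (α t).2 (α t).2 := fun t ht ↦ by
    have : deriv (fun s ↦ (α s).1) =ᶠ[nhds t] fun s ↦ (α s).2 :=
      Filter.eventually_of_mem (isOpen_Ioo.mem_nhds ht) fun s hs ↦ h1 s (hsub hs)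
    rw [this.deriv_eq]
    exact ((ContinuousLinearMap.snd ℝ E E).hasFDerivAt.comp_hasDerivAt t (hαI t (hsub ht))).deriv
  have h0 : (0 : ℝ) ∈ Set.Icc (-ε) ε := ⟨by linarith, hε0.le⟩
  refine ⟨ε, hε0, fun t ↦ (α t).1, contDiff_fst.comp_contDiffOn (hαs.mono hsub),
    fun t ht ↦ (hOI t (hsub ht)).1, by simp [hα0], by rw [h1 0 h0, hα0], fun t ht ↦ ?_,
    fun t ht ↦ ?_⟩
  · rw [h1 t (hsub ht)]
    exact (hOI t (hsub ht)).2
  · rw [h2 t ht, h1 t (hsub ht)]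
    simp

/-- A parallel field that vanishes at a point vanishes nearby. -/
lemma IsMetricOn.eventually_eq_zero_of_parallel (hb : IsMetricOn b D) (hy : y ∈ D) {P : E → E}
    (hP : ContDiffOn ℝ ∞ P D) (hpar : ∀ w ∈ D, ∀ u, fderiv ℝ P w u + connection b w u (P w) = 0)
    (h0 : P y = 0) : ∀ᶠ z in nhds y, P z = 0 := by
  have hcont : ContinuousAt (fun z ↦ ‖connection b z‖) y :=
    (hb.connection_differentiableAt hy).continuousAt.norm
  have h1 : ∀ᶠ z in nhds y, ‖connection b z‖ < ‖connection b y‖ + 1 :=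
    hcont.eventually_lt_const (by linarith)
  obtain ⟨r, hr, hrD⟩ := Metric.eventually_nhds_iff_ball.1 (h1.and (hb.isOpen.mem_nhds hy))
  refine Metric.eventually_nhds_iff_ball.2 ⟨r, hr, fun z hz ↦ ?_⟩
  -- Along a segment from `y` the field solves a linear equation with zero initial value and bounded
  -- coefficients; Grönwall's inequality forces it to vanish.
  let c : ℝ → E := fun t ↦ y + t • (z - y)
  have hc : ∀ t ∈ Set.Icc (0 : ℝ) 1, c t ∈ Metric.ball y r := fun t ht ↦ by
    rw [Metric.mem_ball, dist_eq_norm] at hz ⊢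
    simp only [c, add_sub_cancel_left, norm_smul, Real.norm_eq_abs, abs_of_nonneg ht.1]
    have := ht.2
    nlinarith [norm_nonneg (z - y), ht.1]
  have hcd : ∀ t, HasDerivAt c (z - y) t := fun t ↦ by
    simpa [c] using ((hasDerivAt_id t).smul_const (z - y)).const_add y
  have hd : ∀ t ∈ Set.Icc (0 : ℝ) 1, HasDerivAt (fun t ↦ P (c t))
      (-connection b (c t) (z - y) (P (c t))) t := fun t ht ↦ by
    have hD := (hrD _ (hc t ht)).2
    have h2 := (hP.differentiableAt_of_isOpen hb.isOpen hD).hasFDerivAt.comp_hasDerivAt t (hcd t)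
    rwa [eq_neg_of_add_eq_zero_left (hpar _ hD (z - y))] at h2
  have h3 := norm_le_gronwallBound_of_norm_deriv_right_le (f := fun t ↦ P (c t)) (δ := 0)
    (K := (‖connection b y‖ + 1) * ‖z - y‖) (ε := 0) (a := 0) (b := 1)
    (fun t ht ↦ (hd t ht).continuousAt.continuousWithinAt)
    (fun t ht ↦ (hd t (Set.Ico_subset_Icc_self ht)).hasDerivWithinAt) (by simp [c, h0])
    (fun t ht ↦ by
      rw [norm_neg, add_zero]
      refine ((connection b (c t)).le_opNorm₂ _ _).trans ?_
      have := (hrD _ (hc t (Set.Ico_subset_Icc_self ht))).1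
      gcongr) 1 (by simp)
  simpa [c, gronwallBound_ε0_δ0] using h3

end Geodesics

/-! ### Tensor fields in charts. -/

section Charts

open Bundle

variable {E : Type*} [NormedAddCommGroup E] [NormedSpace ℝ E]
  {M : Type*} [TopologicalSpace M] [ChartedSpace E M]
  {N : Type*} [TopologicalSpace N] [ChartedSpace E N]
  {e e' : OpenPartialHomeomorph M E} {y : E}

/-- The derivative of the coordinate system `e` at the point `x`. -/
def coordDeriv (e : OpenPartialHomeomorph M E) (x : M) : TangentSpace 𝓘(ℝ, E) x →L[ℝ] E :=
  mfderiv 𝓘(ℝ, E) 𝓘(ℝ, E) e x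

/-- The tangent vector with given components in the coordinate system `e`. -/
def coordVector (e : OpenPartialHomeomorph M E) (y : E) : E →L[ℝ] TangentSpace 𝓘(ℝ, E) (e.symm y) :=
  mfderiv 𝓘(ℝ, E) 𝓘(ℝ, E) e.symm y

/-- The components, in the coordinate system `e`, of a field of bilinear forms. -/
def formInChart
    (B : (p : M) → TangentSpace 𝓘(ℝ, E) p →L[ℝ] TangentSpace 𝓘(ℝ, E) p →L[ℝ] ℝ)
    (e : OpenPartialHomeomorph M E) (y : E) : E →L[ℝ] E →L[ℝ] ℝ :=
  ContinuousLinearMap.bilinearComp (E := E) (F := E) (E' := E) (F' := E) (G := ℝ)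
    (B (e.symm y))
    (coordVector e y) (coordVector e y)

/-- The components, in the coordinate system `e`, of a field of endomorphisms. -/
def endInChart (A : (p : M) → TangentSpace 𝓘(ℝ, E) p →L[ℝ] TangentSpace 𝓘(ℝ, E) p)
    (e : OpenPartialHomeomorph M E) (y : E) : E →L[ℝ] E :=
  (coordDeriv e (e.symm y)).comp
    ((A (e.symm y)).comp (coordVector e y))

lemma formInChart_apply
    (B : (p : M) → TangentSpace 𝓘(ℝ, E) p →L[ℝ] TangentSpace 𝓘(ℝ, E) p →L[ℝ] ℝ)
    (e : OpenPartialHomeomorph M E) (y : E) (v w : E) :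
    formInChart B e y v w = B (e.symm y) (coordVector e y v)
      (coordVector e y w) := rfl

lemma endInChart_apply (A : (p : M) → TangentSpace 𝓘(ℝ, E) p →L[ℝ] TangentSpace 𝓘(ℝ, E) p)
    (e : OpenPartialHomeomorph M E) (y : E) (v : E) :
    endInChart A e y v = coordDeriv e (e.symm y)
      (A (e.symm y) (coordVector e y v)) := rfl

lemma mdifferentiable_of_mem_maximalAtlas (he : e ∈ IsManifold.maximalAtlas 𝓘(ℝ, E) ∞ M) :
    e.MDifferentiable 𝓘(ℝ, E) 𝓘(ℝ, E) :=
  ⟨(contMDiffOn_of_mem_maximalAtlas he).mdifferentiableOn (by simp),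
    (contMDiffOn_symm_of_mem_maximalAtlas he).mdifferentiableOn (by simp)⟩

/-- The change of coordinates between two charts. -/
lemma contDiffOn_transition (he : e ∈ IsManifold.maximalAtlas 𝓘(ℝ, E) ∞ M)
    (he' : e' ∈ IsManifold.maximalAtlas 𝓘(ℝ, E) ∞ M) :
    ContDiffOn ℝ ∞ (e' ∘ e.symm) (e.target ∩ e.symm ⁻¹' e'.source) :=
  ((contMDiffOn_of_mem_maximalAtlas he').comp
    ((contMDiffOn_symm_of_mem_maximalAtlas he).mono Set.inter_subset_left)
    fun _ hy ↦ hy.2).contDiffOn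

lemma coordDeriv_coordVector (he : e ∈ IsManifold.maximalAtlas 𝓘(ℝ, E) ∞ M)
    (hy : y ∈ e.target) (v : E) :
    coordDeriv e (e.symm y) (coordVector e y v) = v :=
  DFunLike.congr_fun ((mdifferentiable_of_mem_maximalAtlas he).comp_symm_deriv hy) v

lemma fderiv_comp_chart_symm {F : Type*} [NormedAddCommGroup F] [NormedSpace ℝ F] {f : M → F}
    (hf : ContMDiff 𝓘(ℝ, E) 𝓘(ℝ, F) ∞ f) (he : e ∈ IsManifold.maximalAtlas 𝓘(ℝ, E) ∞ M)
    (hy : y ∈ e.target) (v : E) :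
    fderiv ℝ (f ∘ e.symm) y v = mfderiv 𝓘(ℝ, E) 𝓘(ℝ, F) f (e.symm y)
      (coordVector e y v) := by
  rw [← mfderiv_eq_fderiv, mfderiv_comp (I' := 𝓘(ℝ, E)) y
    (hf.mdifferentiableAt (by simp))
    ((mdifferentiable_of_mem_maximalAtlas he).mdifferentiableAt_symm hy)]
  rfl

lemma fderiv_transition (he : e ∈ IsManifold.maximalAtlas 𝓘(ℝ, E) ∞ M)
    (he' : e' ∈ IsManifold.maximalAtlas 𝓘(ℝ, E) ∞ M)
    (hy : y ∈ e.target ∩ e.symm ⁻¹' e'.source) (v : E) :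
    fderiv ℝ (e' ∘ e.symm) y v = coordDeriv e' (e.symm y)
      (coordVector e y v) := by
  rw [← mfderiv_eq_fderiv, mfderiv_comp (I' := 𝓘(ℝ, E)) y
    ((mdifferentiable_of_mem_maximalAtlas he').mdifferentiableAt hy.2)
    ((mdifferentiable_of_mem_maximalAtlas he).mdifferentiableAt_symm hy.1)]
  rfl

lemma coordVector_coordDeriv (he : e ∈ IsManifold.maximalAtlas 𝓘(ℝ, E) ∞ M)
    (hy : y ∈ e.target) (v : TangentSpace 𝓘(ℝ, E) (e.symm y)) :
    coordVector e y (coordDeriv e (e.symm y) v) = v := by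
  have hinj : Function.Injective (coordDeriv e (e.symm y)) :=
    (mdifferentiable_of_mem_maximalAtlas he).mfderiv_injective (e.map_target hy)
  exact hinj (coordDeriv_coordVector he hy _)

/-- The pairing of two vectors does not depend on the coordinate system. -/
lemma formInChart_coordDeriv
    (B : (p : M) → TangentSpace 𝓘(ℝ, E) p →L[ℝ] TangentSpace 𝓘(ℝ, E) p →L[ℝ] ℝ)
    (he : e ∈ IsManifold.maximalAtlas 𝓘(ℝ, E) ∞ M) (hy : y ∈ e.target) {x : M}
    (hx : e.symm y = x) (v w : TangentSpace 𝓘(ℝ, E) x) :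
    formInChart B e y (coordDeriv e x v) (coordDeriv e x w) =
      B x v w := by
  subst hx
  rw [formInChart_apply, coordVector_coordDeriv he hy, coordVector_coordDeriv he hy]

lemma coordVector_vectorInChart (he : e ∈ IsManifold.maximalAtlas 𝓘(ℝ, E) ∞ M)
    (hy : y ∈ e.target) (X : (p : M) → TangentSpace 𝓘(ℝ, E) p) :
    coordVector e y (vectorInChart X e y) = X (e.symm y) :=
  coordVector_coordDeriv he hy _

lemma formInChart_vectorInChart
    (B : (p : M) → TangentSpace 𝓘(ℝ, E) p →L[ℝ] TangentSpace 𝓘(ℝ, E) p →L[ℝ] ℝ)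
    (he : e ∈ IsManifold.maximalAtlas 𝓘(ℝ, E) ∞ M)
    (hy : y ∈ e.target) (X Y : (p : M) → TangentSpace 𝓘(ℝ, E) p) :
    formInChart B e y (vectorInChart X e y) (vectorInChart Y e y) =
      B (e.symm y) (X (e.symm y)) (Y (e.symm y)) := by
  rw [formInChart_apply, coordVector_vectorInChart he hy, coordVector_vectorInChart he hy]

lemma vectorInChart_end (A : (p : M) → TangentSpace 𝓘(ℝ, E) p →L[ℝ] TangentSpace 𝓘(ℝ, E) p)
    (he : e ∈ IsManifold.maximalAtlas 𝓘(ℝ, E) ∞ M)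
    (hy : y ∈ e.target) (X : (p : M) → TangentSpace 𝓘(ℝ, E) p) :
    vectorInChart (fun p ↦ A p (X p)) e y = endInChart A e y (vectorInChart X e y) := by
  rw [endInChart_apply, coordVector_vectorInChart he hy]
  rfl

lemma vectorInChart_eq_zero_iff (he : e ∈ IsManifold.maximalAtlas 𝓘(ℝ, E) ∞ M)
    (hy : y ∈ e.target) (X : (p : M) → TangentSpace 𝓘(ℝ, E) p) :
    vectorInChart X e y = 0 ↔ X (e.symm y) = 0 := by
  refine ⟨fun h ↦ ?_, fun h ↦ ?_⟩
  · rw [← coordVector_vectorInChart he hy X, h, map_zero]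
  · exact (congrArg (coordDeriv e (e.symm y)) h).trans (coordDeriv e (e.symm y)).map_zero

lemma formInChart_transition
    (B : (p : M) → TangentSpace 𝓘(ℝ, E) p →L[ℝ] TangentSpace 𝓘(ℝ, E) p →L[ℝ] ℝ)
    (he : e ∈ IsManifold.maximalAtlas 𝓘(ℝ, E) ∞ M)
    (he' : e' ∈ IsManifold.maximalAtlas 𝓘(ℝ, E) ∞ M)
    (hy : y ∈ e.target ∩ e.symm ⁻¹' e'.source) (v w : E) :
    formInChart B e y v w = formInChart B e' ((e' ∘ e.symm) y)
      (fderiv ℝ (e' ∘ e.symm) y v) (fderiv ℝ (e' ∘ e.symm) y w) := by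
  rw [fderiv_transition he he' hy, fderiv_transition he he' hy, formInChart_apply]
  exact (formInChart_coordDeriv B he' (e'.map_source hy.2) (e'.left_inv hy.2) _ _).symm

section

variable [IsManifold 𝓘(ℝ, E) ∞ M] [IsManifold 𝓘(ℝ, E) ∞ N]

lemma contMDiffOn_tangentMap {s : Set M} (hs : IsOpen s) {f : M → N}
    (hf : ContMDiffOn 𝓘(ℝ, E) 𝓘(ℝ, E) ∞ f s) :
    ContMDiffOn 𝓘(ℝ, E).tangent 𝓘(ℝ, E).tangent ∞ (tangentMap 𝓘(ℝ, E) 𝓘(ℝ, E) f)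
      (TotalSpace.proj (F := E) (E := (TangentSpace 𝓘(ℝ, E) : M → Type _)) ⁻¹' s) := by
  refine (hf.contMDiffOn_tangentMapWithin (by simp) hs.uniqueMDiffOn).congr fun p hp ↦ ?_
  simp only [tangentMap, tangentMapWithin]
  rw [mfderivWithin_of_isOpen hs hp]

lemma contMDiffOn_chart_symm_const (he : e ∈ IsManifold.maximalAtlas 𝓘(ℝ, E) ∞ M) (v : E) :
    ContMDiffOn 𝓘(ℝ, E) 𝓘(ℝ, E).tangent ∞ (fun y ↦ (TotalSpace.mk' E (e.symm y)
      (coordVector e y v) : TangentBundle 𝓘(ℝ, E) M)) e.target := by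
  have h1 : ContMDiffOn 𝓘(ℝ, E) 𝓘(ℝ, E).tangent ∞
      (fun y ↦ (⟨y, v⟩ : TangentBundle 𝓘(ℝ, E) E)) e.target :=
    contMDiffOn_vectorSpace_iff_contDiffOn.2 contDiffOn_const
  exact (contMDiffOn_tangentMap e.open_target (contMDiffOn_symm_of_mem_maximalAtlas he)).comp h1
    fun y hy ↦ hy

lemma contDiffOn_vectorInChart (he : e ∈ IsManifold.maximalAtlas 𝓘(ℝ, E) ∞ M)
    {X : (p : M) → TangentSpace 𝓘(ℝ, E) p}
    (hX : ContMDiff 𝓘(ℝ, E) 𝓘(ℝ, E).tangent ∞ (fun p ↦ (⟨p, X p⟩ : TangentBundle 𝓘(ℝ, E) M))) :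
    ContDiffOn ℝ ∞ (vectorInChart X e) e.target := by
  have h1 := (contMDiffOn_tangentMap e.open_source (contMDiffOn_of_mem_maximalAtlas he)).comp
    (hX.comp_contMDiffOn (contMDiffOn_symm_of_mem_maximalAtlas he)) fun y hy ↦ e.map_target hy
  exact ((contMDiff_snd_tangentBundle_modelSpace E 𝓘(ℝ, E)).comp_contMDiffOn h1).contDiffOn

lemma contMDiff_of_vectorInChart {X : (p : M) → TangentSpace 𝓘(ℝ, E) p}
    (hX : ∀ e ∈ IsManifold.maximalAtlas 𝓘(ℝ, E) ∞ M,
      ContDiffOn ℝ ∞ (vectorInChart X e) e.target) :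
    ContMDiff 𝓘(ℝ, E) 𝓘(ℝ, E).tangent ∞ (fun p ↦ (⟨p, X p⟩ : TangentBundle 𝓘(ℝ, E) M)) := by
  intro p
  set e := chartAt E p
  have he : e ∈ IsManifold.maximalAtlas 𝓘(ℝ, E) ∞ M := IsManifold.chart_mem_maximalAtlas p
  have h1 : ContMDiffOn 𝓘(ℝ, E) 𝓘(ℝ, E).tangent ∞
      (fun y ↦ (⟨y, vectorInChart (E := E) X e y⟩ : TangentBundle 𝓘(ℝ, E) E)) e.target :=
    contMDiffOn_vectorSpace_iff_contDiffOn.2 (hX e he)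
  have h2 := ((contMDiffOn_tangentMap e.open_target
    (contMDiffOn_symm_of_mem_maximalAtlas he)).comp h1 fun y hy ↦ hy).comp
    (contMDiffOn_of_mem_maximalAtlas he) fun q hq ↦ e.map_source hq
  refine (h2.congr fun q hq ↦ ?_).contMDiffAt (e.open_source.mem_nhds (mem_chart_source E p))
  have h3 : ∀ x, x = q → (⟨q, X q⟩ : TangentBundle 𝓘(ℝ, E) M) = ⟨x, X x⟩ := by
    rintro x rfl; rfl
  rw [h3 _ (e.left_inv hq)]
  exact congrArg (TotalSpace.mk' E (E := (TangentSpace 𝓘(ℝ, E) : M → Type _)) (e.symm (e q)))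
    (coordVector_vectorInChart he (e.map_source hq) X).symm

lemma contMDiff_iff_chart {F : Type*} [NormedAddCommGroup F] [NormedSpace ℝ F] {f : M → F} :
    ContMDiff 𝓘(ℝ, E) 𝓘(ℝ, F) ∞ f ↔ ∀ e ∈ IsManifold.maximalAtlas 𝓘(ℝ, E) ∞ M,
      ContDiffOn ℝ ∞ (f ∘ e.symm) e.target := by
  refine ⟨fun h e he ↦
    (h.comp_contMDiffOn (contMDiffOn_symm_of_mem_maximalAtlas he)).contDiffOn, fun h p ↦ ?_⟩
  have he : chartAt E p ∈ IsManifold.maximalAtlas 𝓘(ℝ, E) ∞ M :=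
    IsManifold.chart_mem_maximalAtlas p
  have h1 := (h _ he).contMDiffOn.comp (contMDiffOn_of_mem_maximalAtlas he)
    fun q hq ↦ (chartAt E p).map_source hq
  refine (h1.congr fun q hq ↦ ?_).contMDiffAt
    ((chartAt E p).open_source.mem_nhds (mem_chart_source E p))
  simp [(chartAt E p).left_inv hq]

end

variable [IsManifold 𝓘(ℝ, E) ∞ M]

lemma PseudoRiemannianMetric.inChart_eq (g : PseudoRiemannianMetric E M) :
    g.inChart = formInChart g.form := rfl

lemma PseudoRiemannianMetric.contDiffOn_inChart [FiniteDimensional ℝ E]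
    (g : PseudoRiemannianMetric E M) (he : e ∈ IsManifold.maximalAtlas 𝓘(ℝ, E) ∞ M) :
    ContDiffOn ℝ ∞ (formInChart g.form e) e.target := by
  -- In finite dimension smoothness may be tested on fixed coordinate vectors, which reduces it to
  -- pairing smooth sections of the tangent bundle.
  refine contDiffOn_clm_apply.2 fun v ↦ contDiffOn_clm_apply.2 fun w ↦ ?_
  have h1 : ContMDiffOn 𝓘(ℝ, E) (𝓘(ℝ, E).prod 𝓘(ℝ, ℝ)) ∞ (fun y ↦ TotalSpace.mk' ℝ
      (E := Bundle.Trivial M ℝ) (e.symm y) (g.form (e.symm y)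
        (coordVector e y v) (coordVector e y w)))
      e.target := by
    apply ContMDiffOn.clm_bundle_apply₂ (F₁ := E) (F₂ := E)
      (E₁ := (TangentSpace 𝓘(ℝ, E) : M → Type _)) (E₂ := (TangentSpace 𝓘(ℝ, E) : M → Type _))
    · exact g.contMDiff.comp_contMDiffOn (contMDiffOn_symm_of_mem_maximalAtlas he)
    · exact contMDiffOn_chart_symm_const he v
    · exact contMDiffOn_chart_symm_const he w
  intro y hy
  have h2 := h1 y hy
  simp only [contMDiffWithinAt_totalSpace] at h2
  exact h2.2.contDiffWithinAt

end Charts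

/-! ### Global metrics and concircular fields on open sets. -/

section SmoothMetrics

lemma isOpen_chartDomain {E : Type*} [NormedAddCommGroup E] {M : Type*} [TopologicalSpace M]
    (e : OpenPartialHomeomorph M E) {U : Set M} (hU : IsOpen U) :
    IsOpen (e.target ∩ e.symm ⁻¹' U) :=
  e.symm.isOpen_inter_preimage hU

variable {E : Type*} [NormedAddCommGroup E] [NormedSpace ℝ E]
  {M : Type*} [TopologicalSpace M] [ChartedSpace E M]
  {M' : Type*} [TopologicalSpace M'] [ChartedSpace E M']
  {e : OpenPartialHomeomorph M E} {y : E}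

/-- A field of bilinear forms is a pseudo-Riemannian metric, smooth in all coordinate systems. -/
structure IsSmoothMetric
    (B : (p : M) → TangentSpace 𝓘(ℝ, E) p →L[ℝ] TangentSpace 𝓘(ℝ, E) p →L[ℝ] ℝ) : Prop where
  symm : ∀ p v w, B p v w = B p w v
  nondegenerate : ∀ p v, (∀ w, B p v w = 0) → v = 0
  contDiffOn : ∀ e ∈ IsManifold.maximalAtlas 𝓘(ℝ, E) ∞ M,
    ContDiffOn ℝ ∞ (formInChart B e) e.target

lemma IsSmoothMetric.formInChart_nondegenerate
    {B : (p : M) → TangentSpace 𝓘(ℝ, E) p →L[ℝ] TangentSpace 𝓘(ℝ, E) p →L[ℝ] ℝ}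
    (hB : IsSmoothMetric B) (he : e ∈ IsManifold.maximalAtlas 𝓘(ℝ, E) ∞ M) (hy : y ∈ e.target)
    {v : E} (hv : ∀ w, formInChart B e y v w = 0) : v = 0 := by
  have h : coordVector e y v = 0 := by
    refine hB.nondegenerate (e.symm y) (coordVector e y v) fun w ↦ ?_
    have := hv (coordDeriv e (e.symm y) w)
    rwa [formInChart_apply, coordVector_coordDeriv he hy] at this
  rw [← coordDeriv_coordVector he hy v, h, map_zero]

lemma IsSmoothMetric.formInChart_symm
    {B : (p : M) → TangentSpace 𝓘(ℝ, E) p →L[ℝ] TangentSpace 𝓘(ℝ, E) p →L[ℝ] ℝ}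
    (hB : IsSmoothMetric B) (e : OpenPartialHomeomorph M E) (y v w : E) :
    formInChart B e y v w = formInChart B e y w v := by
  rw [formInChart_apply, formInChart_apply]
  exact hB.symm (e.symm y) (coordVector e y v) (coordVector e y w)

lemma IsSmoothMetric.isMetricOn
    {B : (p : M) → TangentSpace 𝓘(ℝ, E) p →L[ℝ] TangentSpace 𝓘(ℝ, E) p →L[ℝ] ℝ}
    (hB : IsSmoothMetric B) (he : e ∈ IsManifold.maximalAtlas 𝓘(ℝ, E) ∞ M) :
    IsMetricOn (formInChart B e) e.target :=
  ⟨e.open_target, hB.contDiffOn e he, fun y _ v w ↦ hB.formInChart_symm e y v w,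
    fun _ hy _ hv ↦ hB.formInChart_nondegenerate he hy hv⟩

lemma PseudoRiemannianMetric.isSmoothMetric [FiniteDimensional ℝ E] [IsManifold 𝓘(ℝ, E) ∞ M]
    (g : PseudoRiemannianMetric E M) : IsSmoothMetric g.form :=
  ⟨g.symm, g.nondegenerate, fun _ he ↦ g.contDiffOn_inChart he⟩

lemma PseudoRiemannianMetric.christoffel_eq [IsManifold 𝓘(ℝ, E) ∞ M]
    (g : PseudoRiemannianMetric E M) (e : OpenPartialHomeomorph M E) (y u v : E) :
    g.christoffel e y u v = connection (formInChart g.form e) y u v := by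
  rw [christoffel, connection_apply, inChart_eq]
  congr 1

lemma connection_congr {b b' : E → E →L[ℝ] E →L[ℝ] ℝ} (h : b =ᶠ[nhds y] b') :
    connection b y = connection b' y := by
  rw [connection, connection, lowerConnection, lowerConnection, h.fderiv_eq, h.eq_of_nhds]

/-- The vector field `X` is concircular on `U` with the scalar field `ρ`. -/
structure IsConcircularOn
    (B : (p : M) → TangentSpace 𝓘(ℝ, E) p →L[ℝ] TangentSpace 𝓘(ℝ, E) p →L[ℝ] ℝ)
    (X : (p : M) → TangentSpace 𝓘(ℝ, E) p) (ρ : M → ℝ) (U : Set M) : Prop where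
  smooth_field : ∀ e ∈ IsManifold.maximalAtlas 𝓘(ℝ, E) ∞ M,
    ContDiffOn ℝ ∞ (vectorInChart X e) (e.target ∩ e.symm ⁻¹' U)
  smooth_scalar : ∀ e ∈ IsManifold.maximalAtlas 𝓘(ℝ, E) ∞ M,
    ContDiffOn ℝ ∞ (ρ ∘ e.symm) (e.target ∩ e.symm ⁻¹' U)
  eq : ∀ e ∈ IsManifold.maximalAtlas 𝓘(ℝ, E) ∞ M, ∀ y ∈ e.target ∩ e.symm ⁻¹' U, ∀ u,
    fderiv ℝ (vectorInChart X e) y u + connection (formInChart B e) y u (vectorInChart X e y)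
      = ρ (e.symm y) • u

/-- There is a concircular field on `U` whose scalar field is not identically zero. -/
def HasBasicConcircularFieldOn
    (B : (p : M) → TangentSpace 𝓘(ℝ, E) p →L[ℝ] TangentSpace 𝓘(ℝ, E) p →L[ℝ] ℝ)
    (U : Set M) : Prop :=
  ∃ (X : (p : M) → TangentSpace 𝓘(ℝ, E) p) (ρ : M → ℝ), IsConcircularOn B X ρ U ∧
    ∃ p ∈ U, ρ p ≠ 0

open Classical in
/-- A concircular field on an open and closed set extends by zero. -/
lemma HasBasicConcircularFieldOn.extend
    {B : (p : M) → TangentSpace 𝓘(ℝ, E) p →L[ℝ] TangentSpace 𝓘(ℝ, E) p →L[ℝ] ℝ} {U : Set M}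
    (hU : IsClopen U) (h : HasBasicConcircularFieldOn B U) :
    HasBasicConcircularFieldOn B Set.univ := by
  obtain ⟨X, ρ, hX, p, hpU, hp⟩ := h
  let X' : (p : M) → TangentSpace 𝓘(ℝ, E) p := fun p ↦ if p ∈ U then X p else 0
  let ρ' : M → ℝ := fun p ↦ if p ∈ U then ρ p else 0
  -- Both `U` and its complement are open, so near each point the extension agrees with `X` or with
  -- zero.
  have hXin : ∀ (e : OpenPartialHomeomorph M E), ∀ y ∈ e.target ∩ e.symm ⁻¹' U,
      vectorInChart X' e =ᶠ[nhds y] vectorInChart X e := fun e y hy ↦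
    Filter.eventually_of_mem ((isOpen_chartDomain e hU.isOpen).mem_nhds hy) fun z hz ↦
      congrArg (coordDeriv e (e.symm z)) (if_pos hz.2)
  have hXout : ∀ (e : OpenPartialHomeomorph M E), ∀ y ∈ e.target ∩ e.symm ⁻¹' Uᶜ,
      vectorInChart X' e =ᶠ[nhds y] fun _ ↦ 0 := fun e y hy ↦
    Filter.eventually_of_mem ((isOpen_chartDomain e hU.compl.isOpen).mem_nhds hy) fun z hz ↦
      (congrArg (coordDeriv e (e.symm z)) (if_neg hz.2)).trans
        (coordDeriv e (e.symm z)).map_zero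
  have hρin : ∀ (e : OpenPartialHomeomorph M E), ∀ y ∈ e.target ∩ e.symm ⁻¹' U,
      ρ' ∘ e.symm =ᶠ[nhds y] ρ ∘ e.symm := fun e y hy ↦
    Filter.eventually_of_mem ((isOpen_chartDomain e hU.isOpen).mem_nhds hy) fun z hz ↦ if_pos hz.2
  have hρout : ∀ (e : OpenPartialHomeomorph M E), ∀ y ∈ e.target ∩ e.symm ⁻¹' Uᶜ,
      ρ' ∘ e.symm =ᶠ[nhds y] fun _ ↦ 0 := fun e y hy ↦
    Filter.eventually_of_mem ((isOpen_chartDomain e hU.compl.isOpen).mem_nhds hy) fun z hz ↦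
      if_neg hz.2
  refine ⟨X', ρ', ⟨fun e he y hy ↦ ?_, fun e he y hy ↦ ?_, fun e he y hy u ↦ ?_⟩, p,
    Set.mem_univ p, by simpa [ρ', hpU] using hp⟩
  · by_cases hyU : e.symm y ∈ U
    · exact (((hX.smooth_field e he).contDiffAt ((isOpen_chartDomain e hU.isOpen).mem_nhds
        ⟨hy.1, hyU⟩)).congr_of_eventuallyEq (hXin e y ⟨hy.1, hyU⟩)).contDiffWithinAt
    · exact (contDiffAt_const.congr_of_eventuallyEq (hXout e y ⟨hy.1, hyU⟩)).contDiffWithinAt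
  · by_cases hyU : e.symm y ∈ U
    · exact (((hX.smooth_scalar e he).contDiffAt ((isOpen_chartDomain e hU.isOpen).mem_nhds
        ⟨hy.1, hyU⟩)).congr_of_eventuallyEq (hρin e y ⟨hy.1, hyU⟩)).contDiffWithinAt
    · exact (contDiffAt_const.congr_of_eventuallyEq (hρout e y ⟨hy.1, hyU⟩)).contDiffWithinAt
  · by_cases hyU : e.symm y ∈ U
    · rw [(hXin e y ⟨hy.1, hyU⟩).fderiv_eq, (hXin e y ⟨hy.1, hyU⟩).eq_of_nhds,
        hX.eq e he y ⟨hy.1, hyU⟩ u]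
      simp [ρ', hyU]
    · rw [(hXout e y ⟨hy.1, hyU⟩).fderiv_eq, (hXout e y ⟨hy.1, hyU⟩).eq_of_nhds]
      simp [ρ', hyU]

/-- Nondegeneracy removes the test vector: the defining identity paired with every `X` is `∇_Y φ = ρ
Y`. -/
lemma hasBasicConcircularField_iff [FiniteDimensional ℝ E] [IsManifold 𝓘(ℝ, E) ∞ M]
    (g : PseudoRiemannianMetric E M) :
    HasBasicConcircularField g ↔ HasBasicConcircularFieldOn g.form Set.univ := by
  have key : ∀ (X : (p : M) → TangentSpace 𝓘(ℝ, E) p) (e : OpenPartialHomeomorph M E) (y u : E),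
      covDerivInChart g X e y u = fderiv ℝ (vectorInChart X e) y u
        + connection (formInChart g.form e) y u (vectorInChart X e y) := fun X e y u ↦ by
    rw [covDerivInChart, g.christoffel_eq]
  constructor
  · rintro ⟨X, ρ, hX, p, hp⟩
    refine ⟨X, ρ, ⟨fun e he ↦ ?_, fun e he ↦ ?_, fun e he y hy u ↦ ?_⟩, p, Set.mem_univ p, hp⟩
    · exact (contDiffOn_vectorInChart he hX.smooth_field).mono Set.inter_subset_left
    · exact (contMDiff_iff_chart.1 hX.smooth_scalar e he).mono Set.inter_subset_left
    · have hm := g.isSmoothMetric.isMetricOn he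
      refine hm.ext hy.1 fun w ↦ ?_
      have := hX.eq e he y hy.1 w u
      rw [key, g.inChart_eq, hm.symm y hy.1 w u] at this
      simpa using this
  · rintro ⟨X, ρ, hX, p, _, hp⟩
    refine ⟨X, ρ, ⟨contMDiff_of_vectorInChart fun e he ↦ ?_, contMDiff_iff_chart.2 fun e he ↦ ?_,
      fun e he y hy w u ↦ ?_⟩, p, hp⟩
    · simpa using hX.smooth_field e he
    · simpa using hX.smooth_scalar e he
    · have hm := g.isSmoothMetric.isMetricOn he
      rw [key, hX.eq e he y ⟨hy, Set.mem_univ _⟩, g.inChart_eq, hm.symm y hy w u]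
      simp

end SmoothMetrics

/-! ### Transport by a diffeomorphism. -/

section Transport

variable {E : Type*} [NormedAddCommGroup E] [NormedSpace ℝ E]
  {M : Type*} [TopologicalSpace M] [ChartedSpace E M]
  {M' : Type*} [TopologicalSpace M'] [ChartedSpace E M']
  {e : OpenPartialHomeomorph M E} {y : E}

/-- The coordinate system on `M'` obtained from one on `M` through a diffeomorphism. -/
def transportChart (f : M ≃ₘ⟮𝓘(ℝ, E), 𝓘(ℝ, E)⟯ M') (e : OpenPartialHomeomorph M E) :
    OpenPartialHomeomorph M' E :=
  f.symm.toHomeomorph.toOpenPartialHomeomorph.trans e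

lemma coe_transportChart (f : M ≃ₘ⟮𝓘(ℝ, E), 𝓘(ℝ, E)⟯ M') (e : OpenPartialHomeomorph M E) :
    ⇑(transportChart f e) = e ∘ f.symm := rfl

lemma coe_transportChart_symm (f : M ≃ₘ⟮𝓘(ℝ, E), 𝓘(ℝ, E)⟯ M') (e : OpenPartialHomeomorph M E) :
    ⇑(transportChart f e).symm = f ∘ e.symm := rfl

lemma transportChart_target (f : M ≃ₘ⟮𝓘(ℝ, E), 𝓘(ℝ, E)⟯ M') (e : OpenPartialHomeomorph M E) :
    (transportChart f e).target = e.target := by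
  simp [transportChart]

lemma transportChart_source (f : M ≃ₘ⟮𝓘(ℝ, E), 𝓘(ℝ, E)⟯ M') (e : OpenPartialHomeomorph M E) :
    (transportChart f e).source = f.symm ⁻¹' e.source := by
  simp [transportChart]

/-- Every chart of the target is thus a transported one, so chartwise statements there can be
checked on transported charts alone. -/
lemma transportChart_symm_transportChart (f : M ≃ₘ⟮𝓘(ℝ, E), 𝓘(ℝ, E)⟯ M')
    (e : OpenPartialHomeomorph M' E) : transportChart f (transportChart f.symm e) = e := by
  refine OpenPartialHomeomorph.ext _ _ (fun x ↦ ?_) (fun x ↦ ?_) ?_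
  · simp [coe_transportChart]
  · simp [coe_transportChart_symm]
  · ext x
    simp [transportChart_source]

lemma transportChart_mem_maximalAtlas [IsManifold 𝓘(ℝ, E) ∞ M']
    (f : M ≃ₘ⟮𝓘(ℝ, E), 𝓘(ℝ, E)⟯ M')
    (he : e ∈ IsManifold.maximalAtlas 𝓘(ℝ, E) ∞ M) :
    transportChart f e ∈ IsManifold.maximalAtlas 𝓘(ℝ, E) ∞ M' := by
  rw [IsManifold.mem_maximalAtlas_iff_contMDiffOn]
  constructor
  · rw [transportChart_source, coe_transportChart]
    exact (contMDiffOn_of_mem_maximalAtlas he).comp f.symm.contMDiff.contMDiffOn fun x hx ↦ hx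
  · rw [transportChart_target, coe_transportChart_symm]
    exact f.contMDiff.comp_contMDiffOn (contMDiffOn_symm_of_mem_maximalAtlas he)

/-- The pullback of a field of bilinear forms by a diffeomorphism. -/
def pullbackForm (f : M ≃ₘ⟮𝓘(ℝ, E), 𝓘(ℝ, E)⟯ M')
    (B : (p : M') → TangentSpace 𝓘(ℝ, E) p →L[ℝ] TangentSpace 𝓘(ℝ, E) p →L[ℝ] ℝ) (p : M) :
    TangentSpace 𝓘(ℝ, E) p →L[ℝ] TangentSpace 𝓘(ℝ, E) p →L[ℝ] ℝ :=
  ContinuousLinearMap.bilinearComp (E := E) (F := E) (E' := E) (F' := E) (G := ℝ) (B (f p))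
    (mfderiv 𝓘(ℝ, E) 𝓘(ℝ, E) f p) (mfderiv 𝓘(ℝ, E) 𝓘(ℝ, E) f p)

lemma coordVector_transportChart (f : M ≃ₘ⟮𝓘(ℝ, E), 𝓘(ℝ, E)⟯ M')
    (he : e ∈ IsManifold.maximalAtlas 𝓘(ℝ, E) ∞ M) (hy : y ∈ e.target) (v : E) :
    coordVector (transportChart f e) y v =
      mfderiv 𝓘(ℝ, E) 𝓘(ℝ, E) f (e.symm y) (coordVector e y v) := by
  have h : mfderiv 𝓘(ℝ, E) 𝓘(ℝ, E) (f ∘ e.symm) y =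
      (mfderiv 𝓘(ℝ, E) 𝓘(ℝ, E) f (e.symm y)).comp (mfderiv 𝓘(ℝ, E) 𝓘(ℝ, E) e.symm y) :=
    mfderiv_comp y (f.mdifferentiable (by simp) _)
      ((mdifferentiable_of_mem_maximalAtlas he).mdifferentiableAt_symm hy)
  exact DFunLike.congr_fun h v

/-- In a chart and its transport the diffeomorphism reads as the identity. -/
lemma formInChart_pullbackForm (f : M ≃ₘ⟮𝓘(ℝ, E), 𝓘(ℝ, E)⟯ M')
    (B : (p : M') → TangentSpace 𝓘(ℝ, E) p →L[ℝ] TangentSpace 𝓘(ℝ, E) p →L[ℝ] ℝ)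
    (he : e ∈ IsManifold.maximalAtlas 𝓘(ℝ, E) ∞ M) (hy : y ∈ e.target) :
    formInChart (pullbackForm f B) e y = formInChart B (transportChart f e) y := by
  ext v w
  rw [formInChart_apply B, coordVector_transportChart f he hy, coordVector_transportChart f he hy]
  rfl

lemma IsSmoothMetric.pullbackForm [IsManifold 𝓘(ℝ, E) ∞ M']
    (f : M ≃ₘ⟮𝓘(ℝ, E), 𝓘(ℝ, E)⟯ M')
    {B : (p : M') → TangentSpace 𝓘(ℝ, E) p →L[ℝ] TangentSpace 𝓘(ℝ, E) p →L[ℝ] ℝ}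
    (hB : IsSmoothMetric B) : IsSmoothMetric (pullbackForm f B) where
  symm p v w := hB.symm (f p) (mfderiv 𝓘(ℝ, E) 𝓘(ℝ, E) f p v) (mfderiv 𝓘(ℝ, E) 𝓘(ℝ, E) f p w)
  nondegenerate p v hv := by
    let L := f.mfderivToContinuousLinearEquiv (by simp) p
    have hL : ∀ w, L w = mfderiv 𝓘(ℝ, E) 𝓘(ℝ, E) f p w := fun w ↦ rfl
    have h : L v = 0 := by
      refine hB.nondegenerate (f p) (L v) fun w ↦ ?_
      have := hv (L.symm w)
      have h2 : B (f p) (L v) (L (L.symm w)) = 0 := this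
      rwa [L.apply_symm_apply] at h2
    exact L.map_eq_zero_iff.1 h
  contDiffOn e he := by
    have := hB.contDiffOn _ (transportChart_mem_maximalAtlas f he)
    rw [transportChart_target] at this
    exact this.congr fun y hy ↦ formInChart_pullbackForm f B he hy

/-- The image of a vector field under a diffeomorphism. -/
def pushField (f : M ≃ₘ⟮𝓘(ℝ, E), 𝓘(ℝ, E)⟯ M') (X : (p : M) → TangentSpace 𝓘(ℝ, E) p)
    (q : M') : TangentSpace 𝓘(ℝ, E) q :=
  (mfderiv 𝓘(ℝ, E) 𝓘(ℝ, E) f (f.symm q) (X (f.symm q)) : E)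

lemma vectorInChart_pushField (f : M ≃ₘ⟮𝓘(ℝ, E), 𝓘(ℝ, E)⟯ M')
    (X : (p : M) → TangentSpace 𝓘(ℝ, E) p) (he : e ∈ IsManifold.maximalAtlas 𝓘(ℝ, E) ∞ M)
    (hy : y ∈ e.target) :
    vectorInChart (pushField f X) (transportChart f e) y = vectorInChart X e y := by
  have key : ∀ x, x = e.symm y → mfderiv 𝓘(ℝ, E) 𝓘(ℝ, E) (transportChart f e) (f (e.symm y))
      (mfderiv 𝓘(ℝ, E) 𝓘(ℝ, E) f x (X x) : E) = vectorInChart X e y := by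
    rintro x rfl
    have h1 : (e ∘ f.symm) ∘ f = e := by
      funext p; simp
    have h2 : MDifferentiableAt 𝓘(ℝ, E) 𝓘(ℝ, E) (e ∘ f.symm) (f (e.symm y)) := by
      refine MDifferentiableAt.comp _ ?_ (f.symm.mdifferentiable (by simp) _)
      rw [f.symm_apply_apply]
      exact (mdifferentiable_of_mem_maximalAtlas he).mdifferentiableAt (e.map_target hy)
    have h3 := mfderiv_comp (e.symm y) h2 (f.mdifferentiable (by simp) (e.symm y))
    rw [h1] at h3
    exact (DFunLike.congr_fun h3 _).symm
  exact key _ (f.symm_apply_apply _)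

lemma HasBasicConcircularFieldOn.transport [IsManifold 𝓘(ℝ, E) ∞ M]
    {B : (p : M) → TangentSpace 𝓘(ℝ, E) p →L[ℝ] TangentSpace 𝓘(ℝ, E) p →L[ℝ] ℝ}
    {B' : (p : M') → TangentSpace 𝓘(ℝ, E) p →L[ℝ] TangentSpace 𝓘(ℝ, E) p →L[ℝ] ℝ}
    (f : M ≃ₘ⟮𝓘(ℝ, E), 𝓘(ℝ, E)⟯ M')
    (hf : ∀ e ∈ IsManifold.maximalAtlas 𝓘(ℝ, E) ∞ M, ∀ y ∈ e.target,
      formInChart B e y = formInChart B' (transportChart f e) y)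
    (h : HasBasicConcircularFieldOn B Set.univ) : HasBasicConcircularFieldOn B' Set.univ := by
  obtain ⟨X, ρ, hX, p, _, hp⟩ := h
  have key : ∀ e' ∈ IsManifold.maximalAtlas 𝓘(ℝ, E) ∞ M',
      ∃ e ∈ IsManifold.maximalAtlas 𝓘(ℝ, E) ∞ M, e' = transportChart f e := fun e' he' ↦
    ⟨_, transportChart_mem_maximalAtlas f.symm he', (transportChart_symm_transportChart f e').symm⟩
  refine ⟨pushField f X, ρ ∘ f.symm, ⟨fun e' he' ↦ ?_, fun e' he' ↦ ?_, fun e' he' y hy u ↦ ?_⟩,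
    f p, Set.mem_univ _, by simpa using hp⟩
  · obtain ⟨e, he, rfl⟩ := key e' he'
    rw [transportChart_target, Set.preimage_univ, Set.inter_univ]
    have := hX.smooth_field e he
    rw [Set.preimage_univ, Set.inter_univ] at this
    exact this.congr fun y hy ↦ vectorInChart_pushField f X he hy
  · obtain ⟨e, he, rfl⟩ := key e' he'
    have h1 : (ρ ∘ f.symm) ∘ (transportChart f e).symm = ρ ∘ e.symm := by
      funext y; simp [coe_transportChart_symm]
    rw [transportChart_target, Set.preimage_univ, Set.inter_univ, h1]
    simpa using hX.smooth_scalar e he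
  · obtain ⟨e, he, rfl⟩ := key e' he'
    rw [transportChart_target] at hy
    have h1 : vectorInChart (pushField f X) (transportChart f e) =ᶠ[nhds y] vectorInChart X e :=
      Filter.eventually_of_mem (e.open_target.mem_nhds hy.1) fun z hz ↦
        vectorInChart_pushField f X he hz
    have h2 : formInChart B e =ᶠ[nhds y] formInChart B' (transportChart f e) :=
      Filter.eventually_of_mem (e.open_target.mem_nhds hy.1) fun z hz ↦ hf e he z hz
    rw [h1.fderiv_eq, h1.eq_of_nhds, ← connection_congr h2,
      hX.eq e he y ⟨hy.1, Set.mem_univ _⟩ u]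
    simp [coe_transportChart_symm]

end Transport

/-! ### From geodesic mappings to a one-form. -/

section GeodesicMappings

variable {E : Type*} [NormedAddCommGroup E] [NormedSpace ℝ E] [FiniteDimensional ℝ E]
  {M : Type*} [TopologicalSpace M] [ChartedSpace E M] [IsManifold 𝓘(ℝ, E) ∞ M]
  {M' : Type*} [TopologicalSpace M'] [ChartedSpace E M'] [IsManifold 𝓘(ℝ, E) ∞ M']
  {e : OpenPartialHomeomorph M E} {y : E}

/-- A curve that satisfies the geodesic equation in one coordinate system is a geodesic. -/
lemma isGeodesicCurve_of_chart (g : PseudoRiemannianMetric E M)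
    (he : e ∈ IsManifold.maximalAtlas 𝓘(ℝ, E) ∞ M) {ε : ℝ} {x : ℝ → E}
    (hx : ContDiffOn ℝ ∞ x (Set.Ioo (-ε) ε)) (hxe : ∀ t ∈ Set.Ioo (-ε) ε, x t ∈ e.target)
    (hx0 : ∀ t ∈ Set.Ioo (-ε) ε, deriv x t ≠ 0)
    (hxg : ∀ t ∈ Set.Ioo (-ε) ε, deriv (deriv x) t
      + connection (formInChart g.form e) (x t) (deriv x t) (deriv x t) = 0) :
    IsGeodesicCurve g (Set.Ioo (-ε) ε) (e.symm ∘ x) := by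
  have hsm : ContMDiffOn 𝓘(ℝ, ℝ) 𝓘(ℝ, E) ∞ (e.symm ∘ x) (Set.Ioo (-ε) ε) :=
    (contMDiffOn_symm_of_mem_maximalAtlas he).comp hx.contMDiffOn hxe
  have hxd : ∀ t ∈ Set.Ioo (-ε) ε, DifferentiableAt ℝ x t := fun t ht ↦
    hx.differentiableAt_of_isOpen isOpen_Ioo ht
  have hxd2 : ∀ t ∈ Set.Ioo (-ε) ε, DifferentiableAt ℝ (deriv x) t := fun t ht ↦
    (hx.deriv_of_isOpen isOpen_Ioo (m := ∞) (by simp)).differentiableAt_of_isOpen isOpen_Ioo ht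
  refine ⟨isOpen_Ioo, isPreconnected_Ioo, hsm, fun t ht h0 ↦ hx0 t ht ?_, fun _ ↦ 0,
    fun t ht e' he' hte' ↦ ?_⟩
  · have h1 : x =ᶠ[nhds t] e ∘ (e.symm ∘ x) :=
      Filter.eventually_of_mem (isOpen_Ioo.mem_nhds ht) fun s hs ↦ (e.right_inv (hxe s hs)).symm
    have h2 : mfderiv 𝓘(ℝ, ℝ) 𝓘(ℝ, E) (e ∘ (e.symm ∘ x)) t =
        (mfderiv 𝓘(ℝ, E) 𝓘(ℝ, E) e ((e.symm ∘ x) t)).comp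
          (mfderiv 𝓘(ℝ, ℝ) 𝓘(ℝ, E) (e.symm ∘ x) t) :=
      mfderiv_comp t ((mdifferentiable_of_mem_maximalAtlas he).mdifferentiableAt
        (e.map_target (hxe t ht)))
        ((hsm.contMDiffAt (isOpen_Ioo.mem_nhds ht)).mdifferentiableAt (by simp))
    rw [h0, ContinuousLinearMap.comp_zero, mfderiv_eq_fderiv] at h2
    rw [h1.deriv_eq, ← fderiv_apply_one_eq_deriv, h2]
    rfl
  · set τ := e' ∘ e.symm with hτ
    set O := e.target ∩ e.symm ⁻¹' e'.source
    have hO : IsOpen O := isOpen_chartDomain e e'.open_source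
    have hτs : ContDiffOn ℝ ∞ τ O := contDiffOn_transition he he'
    have htO : x t ∈ O := ⟨hxe t ht, hte'⟩
    have hnear : ∀ᶠ s in nhds t, s ∈ Set.Ioo (-ε) ε ∧ x s ∈ O :=
        Filter.Eventually.and (isOpen_Ioo.mem_nhds ht)
        ((hxd t ht).continuousAt.preimage_mem_nhds (hO.mem_nhds htO))
    have hcomp : e' ∘ (e.symm ∘ x) = τ ∘ x := rfl
    have hd1 : ∀ s ∈ Set.Ioo (-ε) ε, x s ∈ O →
        deriv (τ ∘ x) s = fderiv ℝ τ (x s) (deriv x s) := fun s hs hsO ↦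
      ((hτs.differentiableAt_of_isOpen hO hsO).hasFDerivAt.comp_hasDerivAt s
        (hxd s hs).hasDerivAt).deriv
    have hd2 : deriv (deriv (τ ∘ x)) t = fderiv ℝ (fderiv ℝ τ) (x t) (deriv x t) (deriv x t)
        + fderiv ℝ τ (x t) (deriv (deriv x) t) := by
      have h1 : deriv (τ ∘ x) =ᶠ[nhds t] fun s ↦ fderiv ℝ τ (x s) (deriv x s) :=
        hnear.mono fun s hs ↦ hd1 s hs.1 hs.2
      have h2 : DifferentiableAt ℝ (fderiv ℝ τ) (x t) :=
        (hτs.fderiv_of_isOpen hO (m := ∞) (by simp)).differentiableAt_of_isOpen hO htO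
      rw [h1.deriv_eq]
      exact ((h2.hasFDerivAt.comp_hasDerivAt t (hxd t ht).hasDerivAt).clm_apply
        (hxd2 t ht).hasDerivAt).deriv
    have hb := g.isSmoothMetric.isMetricOn he
    have hb' := g.isSmoothMetric.isMetricOn he'
    -- The second derivative of the transition map in the transformation law matches the extra term
    -- in the second derivative of the curve.
    have htr := connection_transform hb hb' hO Set.inter_subset_left hτs
      (fun z hz ↦ e'.map_source hz.2)
      (fun z hz v w ↦ formInChart_transition g.form he he' hz v w) htO (deriv x t) (deriv x t)
    have h3 := congrArg (fderiv ℝ τ (x t)) (hxg t ht)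
    rw [map_add, htr, map_zero] at h3
    rw [hcomp, hd2, hd1 t ht htO, g.christoffel_eq, zero_smul]
    rw [← h3]
    show _ + connection _ (τ (x t)) _ _ = _
    abel

/-- A geodesic mapping changes the connection by a one-form. -/
lemma IsGeodesicMapping.exists_oneForm {g : PseudoRiemannianMetric E M}
    {g' : PseudoRiemannianMetric E M'} {f : M ≃ₘ⟮𝓘(ℝ, E), 𝓘(ℝ, E)⟯ M'}
    (hf : IsGeodesicMapping g g' f) (he : e ∈ IsManifold.maximalAtlas 𝓘(ℝ, E) ∞ M)
    (hy : y ∈ e.target) :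
    ∃ ψ : E →L[ℝ] ℝ, ∀ u v, connection (formInChart (pullbackForm f g'.form) e) y u v =
      connection (formInChart g.form e) y u v + ψ u • v + ψ v • u := by
  have hb := g.isSmoothMetric.isMetricOn he
  have hb' := (g'.isSmoothMetric.pullbackForm f).isMetricOn he
  -- Take the geodesic with initial velocity `u`. In the transported chart its image has the same
  -- coordinates, so subtracting the two geodesic equations at time `0` makes the difference of
  -- connections at `(u, u)` a multiple of `u`.
  have key : ∀ u : E, u ≠ 0 → ∃ κ : ℝ, (connection (formInChart (pullbackForm f g'.form) e) y
      - connection (formInChart g.form e) y) u u = κ • u := fun u hu ↦ by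
    obtain ⟨ε, hε, x, hx, hxe, hx0, hxu, hxne, hxg⟩ := hb.exists_geodesic hy hu
    obtain ⟨κ, hκ⟩ := (hf _ _ (isGeodesicCurve_of_chart g he hx hxe hxne hxg)).eq
    have h0 : (0 : ℝ) ∈ Set.Ioo (-ε) ε := ⟨by linarith, hε⟩
    have hsrc : (f ∘ e.symm ∘ x) 0 ∈ (transportChart f e).source := by
      rw [transportChart_source]
      simpa using e.map_target (hxe 0 h0)
    have h1 := hκ 0 h0 _ (transportChart_mem_maximalAtlas f he) hsrc
    have h2 : ∀ t ∈ Set.Ioo (-ε) ε, (transportChart f e ∘ f ∘ e.symm ∘ x) t = x t := fun t ht ↦ by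
      simp [coe_transportChart, e.right_inv (hxe t ht)]
    have h3 : transportChart f e ∘ f ∘ e.symm ∘ x =ᶠ[nhds 0] x :=
      Filter.eventually_of_mem (isOpen_Ioo.mem_nhds h0) h2
    have h4 : transportChart f e ((f ∘ e.symm ∘ x) 0) = y := (h2 0 h0).trans hx0
    have h5 : formInChart (pullbackForm f g'.form) e =ᶠ[nhds y]
        formInChart g'.form (transportChart f e) :=
      Filter.eventually_of_mem (e.open_target.mem_nhds hy) fun z hz ↦
        formInChart_pullbackForm f _ he hz
    have h6 := hxg 0 h0
    rw [h4, g'.christoffel_eq, h3.deriv.deriv_eq, h3.deriv_eq, hxu, ← connection_congr h5] at h1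
    rw [hx0, hxu] at h6
    refine ⟨κ 0, ?_⟩
    rw [sub_apply, sub_apply, ← h1]
    rw [eq_neg_of_add_eq_zero_left h6]
    abel
  obtain ⟨ψ, hψ⟩ := exists_oneForm_of_forall_eq_smul
    (connection (formInChart (pullbackForm f g'.form) e) y - connection (formInChart g.form e) y)
    (fun u v ↦ by
      rw [sub_apply, sub_apply, sub_apply, sub_apply, hb.connection_symm hy,
        hb'.connection_symm hy]) key
  refine ⟨ψ, fun u v ↦ ?_⟩
  have := hψ u v
  rw [sub_apply, sub_apply] at this
  rw [add_assoc, ← this]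
  abel

end GeodesicMappings

/-! ### Vanishing of the moments. -/

section ParallelMoments

variable {E : Type*} [NormedAddCommGroup E] [NormedSpace ℝ E]
  {M : Type*} [TopologicalSpace M] [ChartedSpace E M]
  {B : (p : M) → TangentSpace 𝓘(ℝ, E) p →L[ℝ] TangentSpace 𝓘(ℝ, E) p →L[ℝ] ℝ}
  {A : (p : M) → TangentSpace 𝓘(ℝ, E) p →L[ℝ] TangentSpace 𝓘(ℝ, E) p}
  {l : (p : M) → TangentSpace 𝓘(ℝ, E) p} {U : Set M}
  {e : OpenPartialHomeomorph M E} {y : E}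

lemma vectorInChart_smul (r : M → ℝ) (X : (p : M) → TangentSpace 𝓘(ℝ, E) p)
    (e : OpenPartialHomeomorph M E) (y : E) :
    vectorInChart (fun p ↦ r p • X p) e y = r (e.symm y) • vectorInChart (E := E) X e y :=
  (coordDeriv e (e.symm y)).map_smul (r (e.symm y)) (X (e.symm y))

lemma vectorInChart_sub (X Y : (p : M) → TangentSpace 𝓘(ℝ, E) p)
    (e : OpenPartialHomeomorph M E) (y : E) :
    vectorInChart (fun p ↦ X p - Y p) e y =
      vectorInChart (E := E) X e y - vectorInChart (E := E) Y e y :=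
  (coordDeriv e (e.symm y)).map_sub (X (e.symm y)) (Y (e.symm y))

lemma vectorInChart_end_pow (he : e ∈ IsManifold.maximalAtlas 𝓘(ℝ, E) ∞ M) (hy : y ∈ e.target)
    (X : (p : M) → TangentSpace 𝓘(ℝ, E) p) (m : ℕ) :
    vectorInChart (fun p ↦ (A p ^ m) (X p)) e y =
      (endInChart A e y ^ m) (vectorInChart (E := E) X e y) := by
  induction m with
  | zero => rfl
  | succ m ih =>
    rw [pow_succ', mul_apply_eq_comp, ← ih, ← vectorInChart_end A he hy]
    simp only [pow_succ', mul_apply_eq_comp]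

/-- The equation `(∇_u A) v = B(u, v) l + B(l, v) u` for a self-adjoint field of operators. -/
structure IsProjectiveOperator
    (B : (p : M) → TangentSpace 𝓘(ℝ, E) p →L[ℝ] TangentSpace 𝓘(ℝ, E) p →L[ℝ] ℝ)
    (A : (p : M) → TangentSpace 𝓘(ℝ, E) p →L[ℝ] TangentSpace 𝓘(ℝ, E) p)
    (l : (p : M) → TangentSpace 𝓘(ℝ, E) p) : Prop where
  contDiffOn_end : ∀ e ∈ IsManifold.maximalAtlas 𝓘(ℝ, E) ∞ M,
    ContDiffOn ℝ ∞ (endInChart A e) e.target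
  contDiffOn_vector : ∀ e ∈ IsManifold.maximalAtlas 𝓘(ℝ, E) ∞ M,
    ContDiffOn ℝ ∞ (vectorInChart l e) e.target
  self_adjoint : ∀ p v w, B p (A p v) w = B p v (A p w)
  eq : ∀ e ∈ IsManifold.maximalAtlas 𝓘(ℝ, E) ∞ M, ∀ y ∈ e.target, ∀ u v,
    fderiv ℝ (endInChart A e) y u v =
      -connection (formInChart B e) y u (endInChart A e y v)
        + endInChart A e y (connection (formInChart B e) y u v)
        + formInChart B e y u v • vectorInChart l e y
        + formInChart B e y (vectorInChart l e y) v • u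

lemma IsProjectiveOperator.endInChart_self_adjoint (hA : IsProjectiveOperator B A l)
    (he : e ∈ IsManifold.maximalAtlas 𝓘(ℝ, E) ∞ M) (hy : y ∈ e.target) (v w : E) :
    formInChart B e y (endInChart A e y v) w = formInChart B e y v (endInChart A e y w) := by
  rw [formInChart_apply, formInChart_apply, endInChart_apply, endInChart_apply,
    coordVector_coordDeriv he hy, coordVector_coordDeriv he hy]
  exact hA.self_adjoint (e.symm y) (coordVector e y v) (coordVector e y w)

/-- If `l` is parallel and there is no concircular field of the basic type, then all moments of
parallel fields vanish. -/
lemma IsProjectiveOperator.moment_eq_zero [FiniteDimensional ℝ E]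
    [IsManifold 𝓘(ℝ, E) ∞ M] (hB : IsSmoothMetric B) (hA : IsProjectiveOperator B A l)
    (hU : IsOpen U) (hl : IsConcircularOn B l 0 U) (hno : ¬ HasBasicConcircularFieldOn B U)
    (m : ℕ) :
    ∀ Q : (p : M) → TangentSpace 𝓘(ℝ, E) p, IsConcircularOn B Q 0 U →
      ∀ p ∈ U, B p (l p) ((A p ^ m) (Q p)) = 0 := by
  induction m using Nat.strong_induction_on with
  | _ m ih =>
  intro Q hQ
  -- The claim is made for all parallel `Q` at once, because the inductive step applies it to the
  -- new field `X`.
  let G : M → ℝ := fun p ↦ B p (l p) ((A p ^ m) (Q p))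
  let F : M → ℝ := fun p ↦ B p ((A p ^ (m + 1)) (Q p)) (Q p)
  let X : (p : M) → TangentSpace 𝓘(ℝ, E) p := fun p ↦ (2 * G p) • A p (Q p) - F p • l p
  let ρ : M → ℝ := fun p ↦ 2 * G p * B p (l p) (Q p)
  have hGc : ∀ e ∈ IsManifold.maximalAtlas 𝓘(ℝ, E) ∞ M, ∀ y ∈ e.target, G (e.symm y) =
      formInChart B e y (vectorInChart l e y) ((endInChart A e y ^ m) (vectorInChart Q e y)) :=
    fun e he y hy ↦ by
      rw [← vectorInChart_end_pow he hy, formInChart_vectorInChart B he hy]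
  have hFc : ∀ e ∈ IsManifold.maximalAtlas 𝓘(ℝ, E) ∞ M, ∀ y ∈ e.target, F (e.symm y) =
      formInChart B e y ((endInChart A e y ^ (m + 1)) (vectorInChart Q e y))
        (vectorInChart Q e y) := fun e he y hy ↦ by
    rw [← vectorInChart_end_pow he hy, formInChart_vectorInChart B he hy]
  have hXc : ∀ e ∈ IsManifold.maximalAtlas 𝓘(ℝ, E) ∞ M, ∀ y ∈ e.target, vectorInChart X e y =
      (2 * formInChart B e y (vectorInChart l e y)
        ((endInChart A e y ^ m) (vectorInChart Q e y))) • endInChart A e y (vectorInChart Q e y)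
      - formInChart B e y ((endInChart A e y ^ (m + 1)) (vectorInChart Q e y))
        (vectorInChart Q e y) • vectorInChart (E := E) l e y := fun e he y hy ↦ by
    rw [← hGc e he y hy, ← hFc e he y hy, ← vectorInChart_end A he hy]
    exact (vectorInChart_sub (fun p ↦ (2 * G p) • A p (Q p)) (fun p ↦ F p • l p) e y).trans
      (congrArg₂ (· - ·) (vectorInChart_smul (fun p ↦ 2 * G p) (fun p ↦ A p (Q p)) e y)
        (vectorInChart_smul F l e y))
  have hX : IsConcircularOn B X ρ U := by
    refine ⟨fun e he ↦ ?_, fun e he ↦ ?_, fun e he y hy u ↦ ?_⟩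
    · have hsub : e.target ∩ e.symm ⁻¹' U ⊆ e.target := Set.inter_subset_left
      have hb := (hB.contDiffOn e he).mono hsub
      have hAe := (hA.contDiffOn_end e he).mono hsub
      have hle := (hA.contDiffOn_vector e he).mono hsub
      have hQe := hQ.smooth_field e he
      refine ContDiffOn.congr (((contDiffOn_const.mul ((hb.clm_apply hle).clm_apply
        (hAe.clm_pow_apply hQe m))).smul (hAe.clm_apply hQe)).sub
        (((hb.clm_apply (hAe.clm_pow_apply hQe (m + 1))).clm_apply hQe).smul hle))
        fun y hy ↦ hXc e he y hy.1
    · have hsub : e.target ∩ e.symm ⁻¹' U ⊆ e.target := Set.inter_subset_left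
      have hb := (hB.contDiffOn e he).mono hsub
      have hAe := (hA.contDiffOn_end e he).mono hsub
      have hle := (hA.contDiffOn_vector e he).mono hsub
      have hQe := hQ.smooth_field e he
      refine ContDiffOn.congr (((contDiffOn_const (c := (2 : ℝ))).mul ((hb.clm_apply hle).clm_apply
        (hAe.clm_pow_apply hQe m))).mul ((hb.clm_apply hle).clm_apply hQe)) fun y hy ↦ ?_
      rw [← hGc e he y hy.1, formInChart_vectorInChart B he hy.1]
      rfl
    · have hsub : e.target ∩ e.symm ⁻¹' U ⊆ e.target := Set.inter_subset_left
      have hO := isOpen_chartDomain e hU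
      have h1 : vectorInChart X e =ᶠ[nhds y] _ :=
        Filter.eventually_of_mem (hO.mem_nhds hy) fun z hz ↦ hXc e he z hz.1
      rw [h1.fderiv_eq, hXc e he y hy.1]
      have hvan : ∀ R : (p : M) → TangentSpace 𝓘(ℝ, E) p, IsConcircularOn B R 0 U → ∀ j < m,
          formInChart B e y (vectorInChart l e y)
            ((endInChart A e y ^ j) (vectorInChart R e y)) = 0 := fun R hR j hj ↦ by
        rw [← vectorInChart_end_pow he hy.1, formInChart_vectorInChart B he hy.1]
        exact ih j hj R hR _ hy.2
      have h2 := ((hB.isMetricOn he).mono hsub hO).covDeriv_combination hy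
        ((hA.contDiffOn_end e he).mono hsub) ((hA.contDiffOn_vector e he).mono hsub)
        (hQ.smooth_field e he) (hA.endInChart_self_adjoint he hy.1)
        (fun w hw ↦ hA.eq e he w hw.1) (fun u ↦ by simpa using hQ.eq e he y hy u)
        (fun u ↦ by simpa using hl.eq e he y hy u) (hvan Q hQ) (hvan l hl) u
      rw [h2, ← hGc e he y hy.1, formInChart_vectorInChart B he hy.1]
  by_contra! hc
  obtain ⟨p, hpU, hp⟩ := hc
  rcases m with _ | m
  -- For `m = 0` the scalar of `X` is `2 G²`, so a nonzero moment yields a basic field.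
  · exact hno ⟨X, ρ, hX, p, hpU, mul_ne_zero (mul_ne_zero two_ne_zero hp) hp⟩
  -- For positive order the zeroth moment vanishes, so `X` is parallel. The preceding moment of `X`
  -- equals `2 G²`, because that of `l` is zero; the induction hypothesis gives `G = 0`.
  · have hρ0 : ∀ q ∈ U, ρ q = 0 := fun q hq ↦ by
      have : B q (l q) (Q q) = 0 := ih 0 (Nat.succ_pos m) Q hQ q hq
      simp only [ρ, this, mul_zero]
    have hX0 : IsConcircularOn B X 0 U := by
      refine ⟨hX.smooth_field, fun e he ↦ contDiffOn_const, fun e he y hy u ↦ ?_⟩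
      rw [hX.eq e he y hy u, hρ0 _ hy.2, Pi.zero_apply]
    have h1 := ih m (Nat.lt_succ_self m) X hX0 p hpU
    have h2 := ih m (Nat.lt_succ_self m) l hl p hpU
    have h3 : B p (l p) ((A p ^ m) (A p (Q p))) = G p := by
      simp only [G, pow_succ, mul_apply_eq_comp]
    simp only [X, map_sub, map_smul, h2, h3, smul_eq_mul, mul_zero, sub_zero] at h1
    refine (show G p ≠ 0 from hp) ?_
    simpa using h1

end ParallelMoments

/-! ### The global operator equation of projectively related metrics. -/

section ProjectiveChange

variable {E : Type*} [NormedAddCommGroup E] [NormedSpace ℝ E]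
  {M : Type*} [TopologicalSpace M] [ChartedSpace E M]
  {B H : (p : M) → TangentSpace 𝓘(ℝ, E) p →L[ℝ] TangentSpace 𝓘(ℝ, E) p →L[ℝ] ℝ}
  {e : OpenPartialHomeomorph M E} {y : E}

/-- The operator `R` with `B(R v, w) = H(v, w)`. -/
def metricRatio (B H : (p : M) → TangentSpace 𝓘(ℝ, E) p →L[ℝ] TangentSpace 𝓘(ℝ, E) p →L[ℝ] ℝ)
    (p : M) : TangentSpace 𝓘(ℝ, E) p →L[ℝ] TangentSpace 𝓘(ℝ, E) p :=
  (B p).inverse.comp (H p)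

/-- The potential of the one-form of a projective change of metric from `B` to `H`. -/
def metricPotential
    (B H : (p : M) → TangentSpace 𝓘(ℝ, E) p →L[ℝ] TangentSpace 𝓘(ℝ, E) p →L[ℝ] ℝ) (p : M) : ℝ :=
  (2 * (Module.finrank ℝ E + 1 : ℝ))⁻¹ *
    Real.log (LinearMap.det
      (metricRatio B H p : TangentSpace 𝓘(ℝ, E) p →ₗ[ℝ] TangentSpace 𝓘(ℝ, E) p))

/-- The differential of a function, as a linear form on the tangent space. -/
def differential (Ψ : M → ℝ) (p : M) : TangentSpace 𝓘(ℝ, E) p →L[ℝ] ℝ :=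
  mfderiv 𝓘(ℝ, E) 𝓘(ℝ, ℝ) Ψ p

/-- The vector field dual, with respect to `B`, to the differential of a function. -/
def metricGradient (B : (p : M) → TangentSpace 𝓘(ℝ, E) p →L[ℝ] TangentSpace 𝓘(ℝ, E) p →L[ℝ] ℝ)
    (Ψ : M → ℝ) (p : M) : TangentSpace 𝓘(ℝ, E) p :=
  (B p).inverse (differential Ψ p)

/-- The operator of the equation of projectively equivalent metrics. -/
def projectiveOperator
    (B H : (p : M) → TangentSpace 𝓘(ℝ, E) p →L[ℝ] TangentSpace 𝓘(ℝ, E) p →L[ℝ] ℝ)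
    (p : M) : TangentSpace 𝓘(ℝ, E) p →L[ℝ] TangentSpace 𝓘(ℝ, E) p :=
  Real.exp (-2 * metricPotential B H p) • metricRatio B H p

/-- The vector field of the equation of projectively equivalent metrics. -/
def projectiveField
    (B H : (p : M) → TangentSpace 𝓘(ℝ, E) p →L[ℝ] TangentSpace 𝓘(ℝ, E) p →L[ℝ] ℝ)
    (p : M) : TangentSpace 𝓘(ℝ, E) p :=
  Real.exp (-2 * metricPotential B H p) • metricGradient B (metricPotential B H) p

/-- Coordinates act by conjugation, so the determinant, and with it the potential, is independent of
the chart. -/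
lemma det_endInChart (A : (p : M) → TangentSpace 𝓘(ℝ, E) p →L[ℝ] TangentSpace 𝓘(ℝ, E) p)
    (he : e ∈ IsManifold.maximalAtlas 𝓘(ℝ, E) ∞ M) (hy : y ∈ e.target) :
    LinearMap.det (endInChart A e y : E →ₗ[ℝ] E) = LinearMap.det
      (A (e.symm y) : TangentSpace 𝓘(ℝ, E) (e.symm y) →ₗ[ℝ] TangentSpace 𝓘(ℝ, E) (e.symm y)) := by
  let c : TangentSpace 𝓘(ℝ, E) (e.symm y) ≃ₗ[ℝ] E := LinearEquiv.ofLinearMap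
    (coordDeriv e (e.symm y) : TangentSpace 𝓘(ℝ, E) (e.symm y) →ₗ[ℝ] E)
    (coordVector e y : E →ₗ[ℝ] TangentSpace 𝓘(ℝ, E) (e.symm y))
    (LinearMap.ext fun v ↦ coordDeriv_coordVector he hy v)
    (LinearMap.ext fun v ↦ coordVector_coordDeriv he hy v)
  exact LinearMap.det_conj _ c

variable [FiniteDimensional ℝ E]

lemma IsSmoothMetric.isInvertible (hB : IsSmoothMetric B) (p : M) : (B p).IsInvertible :=
  isInvertible_of_nondegenerate (E := E) (B p) (hB.nondegenerate p)

lemma IsSmoothMetric.apply_inverse (hB : IsSmoothMetric B) (p : M)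
    (φ : TangentSpace 𝓘(ℝ, E) p →L[ℝ] ℝ) : B p ((B p).inverse φ) = φ :=
  ((hB.isInvertible p).inverse_apply_eq.1 rfl).symm

lemma metricRatio_apply (hB : IsSmoothMetric B) (p : M) (v w : TangentSpace 𝓘(ℝ, E) p) :
    B p (metricRatio B H p v) w = H p v w := by
  rw [metricRatio, ContinuousLinearMap.comp_apply, hB.apply_inverse]

lemma metricGradient_apply (hB : IsSmoothMetric B) (Ψ : M → ℝ) (p : M)
    (w : TangentSpace 𝓘(ℝ, E) p) :
    B p (metricGradient B Ψ p) w = differential Ψ p w := by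
  rw [metricGradient, hB.apply_inverse]

lemma projectiveOperator_apply (hB : IsSmoothMetric B) (p : M) (v w : TangentSpace 𝓘(ℝ, E) p) :
    B p (projectiveOperator B H p v) w = Real.exp (-2 * metricPotential B H p) * H p v w := by
  rw [projectiveOperator, smul_apply, map_smul, smul_apply, metricRatio_apply hB, smul_eq_mul]

lemma projectiveField_apply (hB : IsSmoothMetric B) (p : M) (w : TangentSpace 𝓘(ℝ, E) p) :
    B p (projectiveField B H p) w =
      Real.exp (-2 * metricPotential B H p) *
        differential (metricPotential B H) p w := by
  rw [projectiveField, map_smul, smul_apply, metricGradient_apply hB, smul_eq_mul]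

lemma projectiveOperator_injective (hB : IsSmoothMetric B) (hH : IsSmoothMetric H) (p : M) :
    Function.Injective (projectiveOperator B H p) := by
  refine (injective_iff_map_eq_zero _).2 fun v hv ↦ hH.nondegenerate p v fun w ↦ ?_
  have := projectiveOperator_apply (H := H) hB p v w
  rw [hv, map_zero, zero_apply] at this
  exact (mul_eq_zero.1 this.symm).resolve_left (Real.exp_pos _).ne'

/-- With `A` and `l` the projective operator and field, evaluate `B(l, A w)` once through `l` and
once through `A`, then cancel the exponential. This turns orthogonality to `l` into a statement
about `dΨ`. -/
lemma form_projectiveField (hB : IsSmoothMetric B) (hH : IsSmoothMetric H) (p : M)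
    (w : TangentSpace 𝓘(ℝ, E) p) :
    H p (projectiveField B H p) w =
      differential (metricPotential B H) p (projectiveOperator B H p w) := by
  have h1 := projectiveField_apply (H := H) hB p (projectiveOperator B H p w)
  rw [hB.symm, projectiveOperator_apply hB, hH.symm] at h1
  exact mul_left_cancel₀ (Real.exp_pos _).ne' h1

/-- After multiplication by `e^{-2Ψ}` both sides equal `B(A v, A w)`. -/
lemma projectiveOperator_self_adjoint (hB : IsSmoothMetric B) (hH : IsSmoothMetric H) (p : M)
    (v w : TangentSpace 𝓘(ℝ, E) p) :
    H p (projectiveOperator B H p v) w = H p v (projectiveOperator B H p w) := by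
  refine mul_left_cancel₀ (Real.exp_pos (-2 * metricPotential B H p)).ne' ?_
  rw [hH.symm p _ w, ← projectiveOperator_apply hB p w, ← projectiveOperator_apply hB p v, hB.symm]

lemma endInChart_metricRatio (hB : IsSmoothMetric B)
    (he : e ∈ IsManifold.maximalAtlas 𝓘(ℝ, E) ∞ M) (hy : y ∈ e.target) :
    endInChart (metricRatio B H) e y = ratio (formInChart B e) (formInChart H e) y := by
  ext v
  refine (hB.isMetricOn he).ext hy fun w ↦ ?_
  rw [ratio_apply (hB.isMetricOn he) hy, formInChart_apply, endInChart_apply,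
    coordVector_coordDeriv he hy, metricRatio_apply hB, formInChart_apply]

lemma metricPotential_chart (hB : IsSmoothMetric B)
    (he : e ∈ IsManifold.maximalAtlas 𝓘(ℝ, E) ∞ M) (hy : y ∈ e.target) :
    metricPotential B H (e.symm y) = projPotential (formInChart B e) (formInChart H e) y := by
  rw [metricPotential, projPotential, ← endInChart_metricRatio hB he hy, det_endInChart _ he hy]

lemma contMDiff_metricPotential [IsManifold 𝓘(ℝ, E) ∞ M] (hB : IsSmoothMetric B)
    (hH : IsSmoothMetric H) : ContMDiff 𝓘(ℝ, E) 𝓘(ℝ, ℝ) ∞ (metricPotential B H) :=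
  contMDiff_iff_chart.2 fun _ he ↦
    (projPotential_contDiffOn (hB.isMetricOn he) (hH.isMetricOn he)).congr fun _ hy ↦
      metricPotential_chart hB he hy

lemma hasFDerivAt_metricPotential (hB : IsSmoothMetric B) (hH : IsSmoothMetric H)
    (he : e ∈ IsManifold.maximalAtlas 𝓘(ℝ, E) ∞ M) (hy : y ∈ e.target) {ψ : E →L[ℝ] ℝ}
    (hψ : ∀ u v, connection (formInChart H e) y u v =
      connection (formInChart B e) y u v + ψ u • v + ψ v • u) :
    HasFDerivAt (metricPotential B H ∘ e.symm) ψ y :=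
  (hasFDerivAt_projPotential (hB.isMetricOn he) (hH.isMetricOn he) hy hψ).congr_of_eventuallyEq
    (Filter.eventually_of_mem (e.open_target.mem_nhds hy) fun _ hz ↦ metricPotential_chart hB he hz)

lemma endInChart_projectiveOperator (hB : IsSmoothMetric B)
    (he : e ∈ IsManifold.maximalAtlas 𝓘(ℝ, E) ∞ M) (hy : y ∈ e.target) :
    endInChart (projectiveOperator B H) e y = Real.exp (-2 * metricPotential B H (e.symm y)) •
      ratio (formInChart B e) (formInChart H e) y := by
  rw [← endInChart_metricRatio hB he hy]
  ext v
  exact (coordDeriv e (e.symm y)).map_smul _ _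

lemma formInChart_projectiveField [IsManifold 𝓘(ℝ, E) ∞ M] (hB : IsSmoothMetric B)
    (hH : IsSmoothMetric H)
    (he : e ∈ IsManifold.maximalAtlas 𝓘(ℝ, E) ∞ M) (hy : y ∈ e.target) (w : E) :
    formInChart B e y (vectorInChart (projectiveField B H) e y) w =
      Real.exp (-2 * metricPotential B H (e.symm y)) *
        fderiv ℝ (metricPotential B H ∘ e.symm) y w := by
  rw [formInChart_apply, coordVector_vectorInChart he hy, projectiveField_apply hB,
    fderiv_comp_chart_symm (contMDiff_metricPotential hB hH) he hy]
  rfl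

/-- Two metrics whose connections differ by a one-form satisfy the equation of projectively
equivalent metrics. -/
lemma isProjectiveOperator_of_projChange [IsManifold 𝓘(ℝ, E) ∞ M] (hB : IsSmoothMetric B)
    (hH : IsSmoothMetric H)
    (hBH : ∀ e ∈ IsManifold.maximalAtlas 𝓘(ℝ, E) ∞ M, ∀ y ∈ e.target, ∃ ψ : E →L[ℝ] ℝ,
      ∀ u v, connection (formInChart H e) y u v =
        connection (formInChart B e) y u v + ψ u • v + ψ v • u) :
    IsProjectiveOperator H (projectiveOperator B H) (projectiveField B H) := by
  have hΨ : ∀ e ∈ IsManifold.maximalAtlas 𝓘(ℝ, E) ∞ M,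
      ContDiffOn ℝ ∞ (metricPotential B H ∘ e.symm) e.target := fun e he ↦
    contMDiff_iff_chart.1 (contMDiff_metricPotential hB hH) e he
  have hexp : ∀ e ∈ IsManifold.maximalAtlas 𝓘(ℝ, E) ∞ M,
      ContDiffOn ℝ ∞ (fun y ↦ Real.exp (-2 * metricPotential B H (e.symm y))) e.target :=
    fun e he ↦ (contDiffOn_const.mul (hΨ e he)).exp
  have hA : ∀ e ∈ IsManifold.maximalAtlas 𝓘(ℝ, E) ∞ M,
      ContDiffOn ℝ ∞ (endInChart (projectiveOperator B H) e) e.target := fun e he ↦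
    ((hexp e he).smul (ratio_contDiffOn (hB.isMetricOn he) (hH.isMetricOn he))).congr
      fun y hy ↦ endInChart_projectiveOperator hB he hy
  refine ⟨hA, fun e he ↦ ?_, projectiveOperator_self_adjoint hB hH, fun e he y hy u v ↦ ?_⟩
  · refine ((hexp e he).smul ((inverse_contDiffOn (hB.isMetricOn he)).clm_apply
      ((hΨ e he).fderiv_of_isOpen e.open_target (m := ∞) (by simp)))).congr fun y hy ↦ ?_
    refine (hB.isMetricOn he).ext hy fun w ↦ ?_
    rw [formInChart_projectiveField hB hH he hy, Pi.smul_apply', map_smul,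
      (hB.isMetricOn he).apply_inverse hy]
    rfl
  · obtain ⟨ψ, hψ⟩ := hBH e he y hy
    have hd := hasFDerivAt_metricPotential hB hH he hy hψ
    refine fderiv_ratio_projChange (hB.isMetricOn he) (hH.isMetricOn he) hy hψ hd
      ((hA e he).differentiableAt_of_isOpen e.open_target hy) (fun z hz v w ↦ ?_) (fun w ↦ ?_) u v
    · rw [endInChart_projectiveOperator hB he hz, smul_apply, map_smul, smul_apply,
        ratio_apply (hB.isMetricOn he) hz]
      rfl
    · rw [formInChart_projectiveField hB hH he hy, hd.fderiv]
      rfl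

end ProjectiveChange

/-! ### Projective invariance of basic concircular fields. -/

section ProjectiveInvariance

variable {E : Type*} [NormedAddCommGroup E] [NormedSpace ℝ E]
  {M : Type*} [TopologicalSpace M] [ChartedSpace E M]
  {B H : (p : M) → TangentSpace 𝓘(ℝ, E) p →L[ℝ] TangentSpace 𝓘(ℝ, E) p →L[ℝ] ℝ}
  {A : (p : M) → TangentSpace 𝓘(ℝ, E) p →L[ℝ] TangentSpace 𝓘(ℝ, E) p}
  {l X P : (p : M) → TangentSpace 𝓘(ℝ, E) p} {ρ : M → ℝ} {U : Set M}

lemma IsConcircularOn.mono {V : Set M} (h : IsConcircularOn B X ρ V) (hUV : U ⊆ V) :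
    IsConcircularOn B X ρ U :=
  ⟨fun e he ↦ (h.smooth_field e he).mono fun _ hy ↦ ⟨hy.1, hUV hy.2⟩,
    fun e he ↦ (h.smooth_scalar e he).mono fun _ hy ↦ ⟨hy.1, hUV hy.2⟩,
    fun e he y hy ↦ h.eq e he y ⟨hy.1, hUV hy.2⟩⟩

lemma IsConcircularOn.isParallelOn (h : IsConcircularOn B X ρ U)
    (hno : ¬ HasBasicConcircularFieldOn B U) : IsConcircularOn B X 0 U := by
  refine ⟨h.smooth_field, fun e he ↦ contDiffOn_const, fun e he y hy u ↦ ?_⟩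
  have : ρ (e.symm y) = 0 := by
    by_contra hc
    exact hno ⟨X, ρ, h, _, hy.2, hc⟩
  rw [h.eq e he y hy u, this, Pi.zero_apply]

lemma IsConcircularOn.contDiffOn (h : IsConcircularOn B X ρ Set.univ)
    {e : OpenPartialHomeomorph M E} (he : e ∈ IsManifold.maximalAtlas 𝓘(ℝ, E) ∞ M) :
    ContDiffOn ℝ ∞ (vectorInChart X e) e.target := by
  simpa using h.smooth_field e he

variable [FiniteDimensional ℝ E] [IsManifold 𝓘(ℝ, E) ∞ M]

/-- The points where a parallel field does not vanish form an open and closed set. -/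
lemma IsSmoothMetric.isClopen_ne_zero (hB : IsSmoothMetric B)
    (hP : IsConcircularOn B P 0 Set.univ) : IsClopen {p | P p ≠ 0} := by
  have key : ∀ p, ∀ᶠ q in nhds p, P q = 0 ↔ P p = 0 := fun p ↦ by
    set e := chartAt E p
    have he : e ∈ IsManifold.maximalAtlas 𝓘(ℝ, E) ∞ M := IsManifold.chart_mem_maximalAtlas p
    have hp : p ∈ e.source := mem_chart_source E p
    have hy := e.map_source hp
    have hz : ∀ q ∈ e.source, vectorInChart P e (e q) = 0 ↔ P q = 0 := fun q hq ↦ by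
      have := vectorInChart_eq_zero_iff he (e.map_source hq) P
      rwa [e.left_inv hq] at this
    have h1 : ∀ᶠ z in nhds (e p), vectorInChart (E := E) P e z = 0 ↔
        vectorInChart (E := E) P e (e p) = 0 := by
      by_cases h0 : vectorInChart (E := E) P e (e p) = 0
      · refine ((hB.isMetricOn he).eventually_eq_zero_of_parallel hy (hP.contDiffOn he)
          (fun w hw u ↦ by simpa using hP.eq e he w ⟨hw, Set.mem_univ _⟩ u) h0).mono
          fun z hz ↦ iff_of_true hz h0
      · exact (((hP.contDiffOn he).differentiableAt_of_isOpen e.open_target hy).continuousAt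
          |>.eventually_ne h0).mono fun z hz ↦ iff_of_false hz h0
    filter_upwards [(e.continuousAt hp).eventually h1, e.open_source.mem_nhds hp] with q hq hqs
    rw [← hz q hqs, hq, hz p hp]
  constructor
  · rw [← isOpen_compl_iff, isOpen_iff_eventually]
    intro p hp
    filter_upwards [key p] with q hq
    simp only [Set.mem_compl_iff, Set.mem_ofPred_eq, not_not] at hp ⊢
    exact hq.2 hp
  · rw [isOpen_iff_eventually]
    intro p hp
    filter_upwards [key p] with q hq
    exact fun h ↦ hp (hq.1 h)

/-- Where there is a non-vanishing parallel field, the vector field of the equation of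
projectively equivalent metrics is concircular. -/
lemma IsProjectiveOperator.exists_isConcircularOn [Nontrivial E] (hH : IsSmoothMetric H)
    (hA : IsProjectiveOperator H A l) (hP : IsConcircularOn H P 0 Set.univ) :
    ∃ μ, IsConcircularOn H l μ {p | P p ≠ 0} := by
  set U := {p | P p ≠ 0}
  have hU : IsOpen U := (hH.isClopen_ne_zero hP).isOpen
  let G : M → ℝ := fun p ↦ H p (l p) (P p)
  have hGc : ∀ e ∈ IsManifold.maximalAtlas 𝓘(ℝ, E) ∞ M, ∀ y ∈ e.target, (G ∘ e.symm) y =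
      formInChart H e y (vectorInChart l e y) (vectorInChart P e y) := fun e he y hy ↦
    (formInChart_vectorInChart H he hy l P).symm
  have hG : ContMDiff 𝓘(ℝ, E) 𝓘(ℝ, ℝ) ∞ G := contMDiff_iff_chart.2 fun e he ↦
    (((hH.contDiffOn e he).clm_apply (hA.contDiffOn_vector e he)).clm_apply
      (hP.contDiffOn he)).congr (hGc e he)
  have hex : ∀ e ∈ IsManifold.maximalAtlas 𝓘(ℝ, E) ∞ M, ∀ y ∈ e.target ∩ e.symm ⁻¹' U, ∃ μ : ℝ,
      ∀ u, fderiv ℝ (vectorInChart l e) y u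
        + connection (formInChart H e) y u (vectorInChart l e y) = μ • u := fun e he y hy ↦ by
    refine (hH.isMetricOn he).exists_covDeriv_eq_smul hy.1 (hA.contDiffOn_end e he)
      (hA.contDiffOn_vector e he) (hA.eq e he) (hP.contDiffOn he) (fun w hw u ↦ ?_)
      fun h0 ↦ hy.2 ((vectorInChart_eq_zero_iff he hy.1 P).1 h0)
    have := hP.eq e he w ⟨hw, Set.mem_univ _⟩ u
    rw [Pi.zero_apply, zero_smul] at this
    exact eq_neg_of_add_eq_zero_left this
  -- Since `P` is parallel, `∇l = μ id` forces `dG = μ H(·, P)`. As `P ≠ 0` on `U`, this determines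
  -- `μ` without reference to a chart.
  have hdG : ∀ e ∈ IsManifold.maximalAtlas 𝓘(ℝ, E) ∞ M, ∀ y ∈ e.target, ∀ μ : ℝ,
      (∀ u, fderiv ℝ (vectorInChart l e) y u
        + connection (formInChart H e) y u (vectorInChart l e y) = μ • u) →
      ∀ w, differential G (e.symm y) w = μ * H (e.symm y) w (P (e.symm y)) :=
    fun e he y hy μ hμ w ↦ by
    have h1 := fderiv_comp_chart_symm hG he hy (coordDeriv e (e.symm y) w)
    have h2 : G ∘ e.symm =ᶠ[nhds y] fun z ↦
        formInChart H e z (vectorInChart l e z) (vectorInChart P e z) :=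
      Filter.eventually_of_mem (e.open_target.mem_nhds hy) (hGc e he)
    rw [h2.fderiv_eq, (hH.isMetricOn he).fderiv_apply_apply hy
      ((hA.contDiffOn_vector e he).differentiableAt_of_isOpen e.open_target hy)
      ((hP.contDiffOn he).differentiableAt_of_isOpen e.open_target hy), hμ,
      hP.eq e he y ⟨hy, Set.mem_univ _⟩, coordVector_coordDeriv he hy, map_smul, smul_apply,
      Pi.zero_apply, zero_smul, map_zero, add_zero, formInChart_apply,
      coordVector_coordDeriv he hy, coordVector_vectorInChart he hy] at h1
    exact h1.symm
  have hμ : ∀ p, ∃ μ : ℝ, p ∈ U → ∀ w, differential G p w = μ * H p w (P p) := fun p ↦ by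
    by_cases hp : p ∈ U
    · have he : chartAt E p ∈ IsManifold.maximalAtlas 𝓘(ℝ, E) ∞ M :=
        IsManifold.chart_mem_maximalAtlas p
      have hs := mem_chart_source E p
      have hl := (chartAt E p).left_inv hs
      obtain ⟨μ, h⟩ := hex _ he (chartAt E p p)
        ⟨(chartAt E p).map_source hs, by rwa [Set.mem_preimage, hl]⟩
      have h2 := hdG _ he _ ((chartAt E p).map_source hs) μ h
      rw [hl] at h2
      exact ⟨μ, fun _ ↦ h2⟩
    · exact ⟨0, fun h ↦ absurd h hp⟩
  choose μ hμ using hμ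
  have heq : ∀ e ∈ IsManifold.maximalAtlas 𝓘(ℝ, E) ∞ M, ∀ y ∈ e.target ∩ e.symm ⁻¹' U, ∀ u,
      fderiv ℝ (vectorInChart l e) y u
        + connection (formInChart H e) y u (vectorInChart l e y) = μ (e.symm y) • u :=
    fun e he y hy u ↦ by
    obtain ⟨ν, hν⟩ := hex e he y hy
    obtain ⟨w, hw⟩ : ∃ w, H (e.symm y) (P (e.symm y)) w ≠ 0 := by
      by_contra! hc
      exact hy.2 (hH.nondegenerate (e.symm y) _ hc)
    have h1 := hdG e he y hy.1 ν hν w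
    rw [hμ _ hy.2 w, hH.symm] at h1
    rw [hν, mul_right_cancel₀ hw h1]
  refine ⟨μ, fun e he ↦ (hA.contDiffOn_vector e he).mono Set.inter_subset_left, fun e he ↦ ?_, heq⟩
  -- A fixed functional with value `1` on `u` extracts `μ` from the vector equation, which proves
  -- its smoothness.
  obtain ⟨u, hu⟩ := exists_ne (0 : E)
  obtain ⟨φ, hφ⟩ := SeparatingDual.exists_eq_one (R := ℝ) hu
  have hsub : e.target ∩ e.symm ⁻¹' U ⊆ e.target := Set.inter_subset_left
  refine ContDiffOn.congr (φ.contDiff.comp_contDiffOn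
    ((((hA.contDiffOn_vector e he).fderiv_of_isOpen e.open_target (m := ∞) (by simp)).clm_apply
      (contDiffOn_const (c := u))).add (((hH.isMetricOn he).connection_contDiffOn.clm_apply
        (contDiffOn_const (c := u))).clm_apply (hA.contDiffOn_vector e he)) |>.mono hsub))
    fun y hy ↦ ?_
  have := congrArg φ (heq e he y hy u)
  rw [map_smul, hφ, smul_eq_mul, mul_one] at this
  exact this.symm

/-- A concircular field is rescaled to a concircular field by a projective change of metric. -/
lemma IsConcircularOn.projChange (hB : IsSmoothMetric B) (hH : IsSmoothMetric H)
    (hBH : ∀ e ∈ IsManifold.maximalAtlas 𝓘(ℝ, E) ∞ M, ∀ y ∈ e.target, ∃ ψ : E →L[ℝ] ℝ,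
      ∀ u v, connection (formInChart H e) y u v =
        connection (formInChart B e) y u v + ψ u • v + ψ v • u)
    (hX : IsConcircularOn B X ρ Set.univ) :
    IsConcircularOn H (fun p ↦ Real.exp (-metricPotential B H p) • X p)
      (fun p ↦ Real.exp (-metricPotential B H p) *
        (ρ p + differential (metricPotential B H) p (X p))) Set.univ := by
  set Ψ := metricPotential B H
  have hΨ := contMDiff_metricPotential hB hH
  have hv : ∀ e : OpenPartialHomeomorph M E,
      vectorInChart (fun p ↦ Real.exp (-Ψ p) • X p) e =
        fun y ↦ Real.exp (-(Ψ ∘ e.symm) y) • vectorInChart (E := E) X e y := fun e ↦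
    funext fun y ↦ vectorInChart_smul (fun p ↦ Real.exp (-Ψ p)) X e y
  have hd : ∀ e ∈ IsManifold.maximalAtlas 𝓘(ℝ, E) ∞ M, ∀ y ∈ e.target,
      differential Ψ (e.symm y) (X (e.symm y)) =
        fderiv ℝ (Ψ ∘ e.symm) y (vectorInChart (E := E) X e y) := fun e he y hy ↦ by
    rw [fderiv_comp_chart_symm hΨ he hy, coordVector_vectorInChart he hy]
    rfl
  refine ⟨fun e he ↦ ?_, fun e he ↦ ?_, fun e he y hy u ↦ ?_⟩
  · rw [hv, Set.preimage_univ, Set.inter_univ]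
    exact (contMDiff_iff_chart.1 hΨ e he).neg.exp.smul (hX.contDiffOn he)
  · have h1 := hX.smooth_scalar e he
    rw [Set.preimage_univ, Set.inter_univ] at h1 ⊢
    have h2 := contMDiff_iff_chart.1 hΨ e he
    refine (h2.neg.exp.mul (h1.add ((h2.fderiv_of_isOpen e.open_target (m := ∞)
      (by simp)).clm_apply (hX.contDiffOn he)))).congr fun y hy ↦ ?_
    rw [Function.comp_apply, hd e he y hy]
    rfl
  · obtain ⟨ψ, hψ⟩ := hBH e he y hy.1
    have h1 := hasFDerivAt_metricPotential hB hH he hy.1 hψ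
    rw [hv]
    rw [hd e he y hy.1, h1.fderiv]
    exact concircular_projChange hψ h1
      ((hX.contDiffOn he).differentiableAt_of_isOpen e.open_target hy.1) (hX.eq e he y hy) u

/-- The existence of concircular fields of the basic type is projectively invariant. -/
theorem HasBasicConcircularFieldOn.projChange (hB : IsSmoothMetric B) (hH : IsSmoothMetric H)
    (hBH : ∀ e ∈ IsManifold.maximalAtlas 𝓘(ℝ, E) ∞ M, ∀ y ∈ e.target, ∃ ψ : E →L[ℝ] ℝ,
      ∀ u v, connection (formInChart H e) y u v =
        connection (formInChart B e) y u v + ψ u • v + ψ v • u)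
    (h : HasBasicConcircularFieldOn B Set.univ) : HasBasicConcircularFieldOn H Set.univ := by
  obtain ⟨X, ρ, hX, p, hp, hρ⟩ := h
  -- In dimension zero the concircular equation is vacuous, so the same field serves.
  rcases subsingleton_or_nontrivial E with hE | hE
  · exact ⟨X, ρ, ⟨hX.smooth_field, hX.smooth_scalar, fun _ _ _ _ _ ↦ Subsingleton.elim _ _⟩,
      p, hp, hρ⟩
  by_contra hno
  have hP' := hX.projChange hB hH hBH
  set Ψ := metricPotential B H
  set P : (p : M) → TangentSpace 𝓘(ℝ, E) p := fun p ↦ Real.exp (-Ψ p) • X p with hPdef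
  have hP := hP'.isParallelOn hno
  -- If `dΨ(P)` vanished at `p`, the scalar of the rescaled field there would be `e^{-Ψ} ρ(p) ≠ 0`,
  -- making it basic.
  have hΨP : differential Ψ p (P p) ≠ 0 := fun hc ↦ by
    refine hno ⟨_, _, hP', p, hp, mul_ne_zero (Real.exp_pos _).ne' ?_⟩
    rw [hPdef, map_smul, smul_eq_mul] at hc
    rwa [(mul_eq_zero.1 hc).resolve_left (Real.exp_pos _).ne', add_zero]
  have hPp : P p ≠ 0 := fun h0 ↦ hΨP (by rw [h0, map_zero])
  have hU := hH.isClopen_ne_zero hP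
  have hnoU : ¬ HasBasicConcircularFieldOn H {p | P p ≠ 0} := fun h ↦ hno (h.extend hU)
  have hA := isProjectiveOperator_of_projChange hB hH hBH
  obtain ⟨μ, hμ⟩ := hA.exists_isConcircularOn hH hP
  have hmom := fun m ↦ hA.moment_eq_zero hH hU.isOpen (hμ.isParallelOn hnoU) hnoU m P
    (hP.mono (Set.subset_univ _)) p hPp
  -- All moments of `P` at `p` vanish, so `P = A w` with `w` orthogonal to `l`; then `dΨ(P) = H(l,
  -- w) = 0`.
  obtain ⟨w, hw, hlw⟩ := exists_preimage_orthogonal (E := E) (B := H p)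
    (projectiveOperator_injective hB hH p) hmom
  have h1 := form_projectiveField (H := H) hB hH p w
  exact hΨP ((congrArg (differential Ψ p) hw).symm.trans (h1.symm.trans hlw))

end ProjectiveInvariance

end

theorem theorem4 (n : ℕ)
    {M : Type*} [TopologicalSpace M] [T2Space M] [SecondCountableTopology M]
    [ChartedSpace (EuclideanSpace ℝ (Fin n)) M]
    [IsManifold 𝓘(ℝ, EuclideanSpace ℝ (Fin n)) ∞ M]
    {M' : Type*} [TopologicalSpace M'] [T2Space M'] [SecondCountableTopology M']
    [ChartedSpace (EuclideanSpace ℝ (Fin n)) M']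
    [IsManifold 𝓘(ℝ, EuclideanSpace ℝ (Fin n)) ∞ M']
    (g : PseudoRiemannianMetric (EuclideanSpace ℝ (Fin n)) M)
    (g' : PseudoRiemannianMetric (EuclideanSpace ℝ (Fin n)) M')
    (h : AdmitsGeodesicMapping g g') :
    (HasBasicConcircularField g' → HasBasicConcircularField g) ∧
      (HasBasicConcircularField g → HasBasicConcircularField g') := by
  obtain ⟨f, hf⟩ := h
  have hg := g.isSmoothMetric
  have hg' := g'.isSmoothMetric.pullbackForm f
  rw [hasBasicConcircularField_iff, hasBasicConcircularField_iff]
  refine ⟨fun h' ↦ ?_, fun h ↦ ?_⟩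
  · have h1 : HasBasicConcircularFieldOn (pullbackForm f g'.form) Set.univ := by
      refine h'.transport f.symm fun e' he' y hy ↦ ?_
      have he := transportChart_mem_maximalAtlas f.symm he'
      rw [formInChart_pullbackForm f _ he (by rwa [transportChart_target])]
      exact congrArg (fun c ↦ formInChart g'.form c y)
        (transportChart_symm_transportChart f e').symm
    refine h1.projChange hg' hg fun e he y hy ↦ ?_
    obtain ⟨ψ, hψ⟩ := hf.exists_oneForm he hy
    -- Exchanging the metrics only changes the sign of the one-form, so it is not necessary to know
    -- that the inverse mapping preserves geodesics.
    refine ⟨-ψ, fun u v ↦ ?_⟩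
    rw [hψ, neg_apply, neg_apply]
    module
  · refine (h.projChange hg hg' fun e he y hy ↦ hf.exists_oneForm he hy).transport f
      fun e he y hy ↦ formInChart_pullbackForm f _ he hy
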